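/- A frequency is a strictly increasing, unbounded sequence $\lambda=(\lambda_n)$ of non-negative real numbers. For a sequence $a=(a_n)$ of complex numbers, $k\ge 0$, $x>0$ and $s\in\mathbb C$ put $$R_x^{\lambda,k}(a)(s)=\sum_{\lambda_n<x}a_ne^{-\lambda_ns}\Big(1-\frac{\lambda_n}{x}\Big)^k .$$ The Dirichlet series $\sum a_ne^{-\lambda_ns}$ is a $\lambda$-Riesz germ of $f\colon[\operatorname{Re}>0]\to\mathbb C$ if there are $m\ge 0$ and $\sigma\ge 0$ with $f(s)=\lim_{x\to\infty}R_x^{\lambda,m}(a)(s)$ for all $s$ with $\operatorname{Re}s>\sigma$. For $\ell\ge0$ let $H_{\infty,\ell}^\lambda[\operatorname{Re}>0]$ be the space of all holomorphic $f\colon[\operatorname{Re}>0]\to\mathbb C$ that have a $\lambda$-Riesz germ and satisfy $$\|f\|_{\infty,\ell}=\sup_{\operatorname{Re}s>0}\frac{|f(s)|}{(1+|s|)^\ell}<\infty .$$ Theorem. Let $\lambda$ be a frequency and $k>\ell\ge0$. (0) Every $f\in H_{\infty,\ell}^\lambda[\operatorname{Re}>0]$ has exactly one $\lambda$-Riesz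 germ $\sum a_n(f)e^{-\lambda_ns}$; so the Riesz means $R_x^{\lambda,k}(f):=R_x^{\lambda,k}((a_n(f))_n)$ are well defined. (1) For every bounded set $M\subset H_{\infty,\ell}^\lambda[\operatorname{Re}>0]$ and all $\varepsilon,u>0$ there is $x_0>0$ such that $$\sup_{x>x_0}\ \sup_{f\in M}\ \big\|f(u+\cdot)-R_x^{\lambda,k}(f)(u+\cdot)\big\|_{\infty,\ell}\le\varepsilon .$$ (2) Let $f\in H_{\infty,\ell}^\lambda[\operatorname{Re}>0]$. For every $u>0$ the functions $f(u+\cdot)$ and $R_x^{\lambda,k}(f)(u+\cdot)$, $x>0$, belong to $H_{\infty,\ell}^\lambda[\operatorname{Re}>0]$ and $R_x^{\lambda,k}(f)(u+\cdot)\to f(u+\cdot)$ in the norm $\|\cdot\|_{\infty,\ell}$ as $x\to\infty$; moreover $$\lim_{x\to\infty}\ \sup_{\operatorname{Re}s>u}\Big|\frac{f(s)-R_x^{\lambda,k}(f)(s)}{(1+s)^\ell}\Big|=0 .$$ (3) If $f\in H_{\infty,\ell}^\lambda[\operatorname{Re}>0]$, then $f(s)=\lim_{x\to\infty}R_x^{\lambda,k}(f)(s)$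 for every $s$ with $\operatorname{Re}s>0$. -/

import Mathlib

noncomputable section

namespace RieszDirichlet

/-- A frequency: a strictly increasing, non-negative, unbounded real sequence. -/
structure Frequency where
  seq : ℕ → ℝ
  strictMono : StrictMono seq
  nonneg : ∀ n, 0 ≤ seq n
  tendsto_atTop : Filter.Tendsto seq Filter.atTop Filter.atTop

theorem Frequency.finite_lt (lam : Frequency) (x : ℝ) : {n : ℕ | lam.seq n < x}.Finite := by
  have h := (lam.tendsto_atTop.eventually_ge_atTop x).exists_forall_of_atTop
  obtain ⟨N, hN⟩ := h
  refine (Set.finite_lt_nat N).subset fun n hn => ?_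
  by_contra hlt
  exact absurd (hN n (not_lt.mp hlt)) (not_le.mpr hn)

/-- The finite set of indices `n` with `λ_n < x`. -/
def Frequency.below (lam : Frequency) (x : ℝ) : Finset ℕ := (lam.finite_lt x).toFinset

/-- The open half-plane `[Re > σ]`. -/
def halfPlane (σ : ℝ) : Set ℂ := {s | σ < s.re}

/-- The `(λ,k)`-Riesz mean `∑_{λ_n < x} a_n e^{-λ_n s} (1 - λ_n / x)^k` of the `λ`-Dirichlet
series with coefficients `a`. -/
def rieszMean (lam : Frequency) (k : ℝ) (a : ℕ → ℂ) (x : ℝ) (s : ℂ) : ℂ :=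
  ∑ n ∈ lam.below x,
    a n * Complex.exp (-(lam.seq n : ℂ) * s) * (((1 - lam.seq n / x) ^ k : ℝ) : ℂ)

/-- The `λ`-Dirichlet series with coefficients `a` is a `λ`-Riesz germ of `f : [Re > 0] → ℂ`:
for some order `m ≥ 0` it is `(λ,m)`-Riesz summable to `f` on some half-plane. -/
def IsRieszGerm (lam : Frequency) (a : ℕ → ℂ) (f : ℂ → ℂ) : Prop :=
  ∃ m : ℝ, 0 ≤ m ∧ ∃ σ : ℝ, ∀ s ∈ halfPlane 0, s ∈ halfPlane σ →
    Filter.Tendsto (fun x : ℝ => rieszMean lam m a x s) Filter.atTop (nhds (f s))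

/-- `‖f‖_{∞,ℓ} = sup_{Re s > 0} |f(s)| / (1 + |s|)^ℓ`, as an extended non-negative number. -/
def growthNorm (l : ℝ) (f : ℂ → ℂ) : ENNReal :=
  ⨆ s ∈ halfPlane 0, ENNReal.ofReal (‖f s‖ / (1 + ‖s‖) ^ l)

/-- The space `H_{∞,ℓ}^λ[Re > 0]`. Its elements are represented by functions on `ℂ`, of which only
the values on `[Re > 0]` matter. -/
def H (lam : Frequency) (l : ℝ) : Set (ℂ → ℂ) :=
  {f | DifferentiableOn ℂ f (halfPlane 0) ∧ (∃ a, IsRieszGerm lam a f) ∧ growthNorm l f < ⊤}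

open Classical in
/-- The sequence of Bohr coefficients of `f`, i.e. the coefficients of a `λ`-Riesz germ of `f`
(and zero if there is no germ). -/
def bohrCoeff (lam : Frequency) (f : ℂ → ℂ) : ℕ → ℂ :=
  if h : ∃ a, IsRieszGerm lam a f then h.choose else 0

/-- The `(λ,k)`-Riesz mean `R_x^{λ,k}(f)(s)` of a function `f` that has a `λ`-Riesz germ. -/
def rieszMeanFun (lam : Frequency) (k : ℝ) (f : ℂ → ℂ) (x : ℝ) (s : ℂ) : ℂ :=
  rieszMean lam k (bohrCoeff lam f) x s

/-- The translate `f(u + ·)`. -/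
def translate (u : ℝ) (f : ℂ → ℂ) : ℂ → ℂ := fun s => f ((u : ℂ) + s)

end RieszDirichlet

end

noncomputable section

namespace RieszDirichlet

open Complex MeasureTheory Set Filter Topology

/-! The engine is a Perron formula. If `f` grows at most like `(1 + |s|)^l`, has a germ `a`, and `k
> l`, then for `Re z > 0` the translate `f(z + ·)` satisfies, for every abscissa `c > 0`, an
identity between its integral against `e^{xw} w^{-(1+k)}` over `[Re w = c]` and `∑_{λ_n < x} a_n
e^{-λ_n z} (x - λ_n)^k` (`IsRieszGerm.perron_formula`). Choosing `c = 1/x` and rescaling `w = v/x`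
turns the Riesz mean at `z` into an average of `f(z + v/x)` over `[Re v = 1]`, with a fixed kernel
of total mass one that stays integrable against `(1 + |v|)^l` (`IsRieszGerm.rieszMean_eq_integral`).
By Cauchy's estimate, `f(z + h) - f(z)` is at most a constant times `(1 + |z|)^l (1 + |h|)^l min(1,
|h|)` on `[Re z ≥ u]`, so dominated convergence gives an error `K η(x) (1 + |z|)^l` with `η → 0`
independent of `f`, the germ and the frequency (`exists_rate_norm_sub_rieszMean_le`). All the
convergence claims follow.

To obtain the Perron formula from a germ, summability is first raised to an integer order `N`.
Bounded means at one point imply polynomially bounded means on the vertical line one unit to the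
right (`exists_norm_rieszMean_le_pow`), so limit and integral may be exchanged: the formula holds
for large order and far to the right (`IsRieszGerm.perron_formula_of_large`). Differentiating in `x`
lowers the order by one as long as it stays above `l`; Cauchy's theorem then moves the line to any
`c > 0`. Uniqueness of the germ also comes from the formula, since the integral does not see the
coefficients. -/

/-! ### Vertical lines and integrable weights. -/

/-- The point `c + it` of the vertical line `[Re = c]`. -/
def vline (c t : ℝ) : ℂ := c + t * I

@[simp] theorem vline_re (c t : ℝ) : (vline c t).re = c := by simp [vline]

@[simp] theorem vline_im (c t : ℝ) : (vline c t).im = t := by simp [vline]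

@[fun_prop]
theorem continuous_vline (c : ℝ) : Continuous (vline c) := by
  unfold vline; fun_prop

theorem le_norm_vline (c t : ℝ) : c ≤ ‖vline c t‖ := by
  simpa using Complex.re_le_norm (vline c t)

theorem abs_le_norm_vline (c t : ℝ) : |t| ≤ ‖vline c t‖ := by
  simpa using Complex.abs_im_le_norm (vline c t)

theorem norm_vline_pos {c : ℝ} (hc : 0 < c) (t : ℝ) : 0 < ‖vline c t‖ :=
  hc.trans_le (le_norm_vline c t)

theorem norm_vline_mono {c c' : ℝ} (h0 : 0 ≤ c) (h : c ≤ c') (t : ℝ) :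
    ‖vline c t‖ ≤ ‖vline c' t‖ := by
  rw [Complex.norm_eq_sqrt_sq_add_sq, Complex.norm_eq_sqrt_sq_add_sq]
  simp only [vline_re, vline_im]
  gcongr

theorem vline_mem_slitPlane {c : ℝ} (hc : 0 < c) (t : ℝ) : vline c t ∈ slitPlane :=
  Or.inl (by simpa using hc)

theorem mem_halfPlane {σ : ℝ} {s : ℂ} : s ∈ halfPlane σ ↔ σ < s.re := Iff.rfl

theorem isOpen_halfPlane (σ : ℝ) : IsOpen (halfPlane σ) :=
  isOpen_lt continuous_const Complex.continuous_re

theorem convex_halfPlane (σ : ℝ) : Convex ℝ (halfPlane σ) :=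
  convex_halfSpace_re_gt σ

theorem halfPlane_subset_slitPlane : halfPlane 0 ⊆ slitPlane := fun _ hz => Or.inl hz

theorem norm_cpow_vline (c t p : ℝ) : ‖vline c t ^ ((p : ℝ) : ℂ)‖ = ‖vline c t‖ ^ p :=
  norm_cpow_real _ _

theorem continuous_vline_cpow {c : ℝ} (hc : 0 < c) (p : ℂ) :
    Continuous fun t : ℝ => vline c t ^ p :=
  (continuous_vline c).cpow continuous_const fun t => vline_mem_slitPlane hc t

/-- Since `|w| ≥ c` on the line, `1 + |w|` and `|w|` are comparable, so the negative power of `|w|`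
can absorb the growth factor. -/
theorem weight_vline_le {l k c : ℝ} (hl : 0 ≤ l) (hkl : l < k) (hc : 0 < c) (t : ℝ) :
    (1 + ‖vline c t‖) ^ l * ‖vline c t‖ ^ (-(1 + k)) ≤
      (1 + 1 / c) ^ (1 + k) * (1 + ‖t‖) ^ (-(1 + k - l)) := by
  have hw := norm_vline_pos hc t
  set r := ‖vline c t‖
  have h1 : 1 + r ≤ (1 + 1 / c) * r := by
    have : 1 ≤ r / c := (one_le_div hc).2 (le_norm_vline c t)
    calc 1 + r ≤ r / c + r := by linarith
      _ = _ := by ring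
  have h2 : r ^ (-(1 + k)) ≤ (1 + 1 / c) ^ (1 + k) * (1 + r) ^ (-(1 + k)) := by
    rw [Real.rpow_neg hw.le, Real.rpow_neg (by positivity), ← div_eq_mul_inv,
      inv_le_iff_one_le_mul₀ (by positivity), div_mul_eq_mul_div,
      one_le_div (by positivity), ← Real.mul_rpow (by positivity) hw.le]
    exact Real.rpow_le_rpow (by positivity) h1 (by linarith)
  calc (1 + r) ^ l * r ^ (-(1 + k))
      ≤ (1 + r) ^ l * ((1 + 1 / c) ^ (1 + k) * (1 + r) ^ (-(1 + k))) := by gcongr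
    _ = (1 + 1 / c) ^ (1 + k) * (1 + r) ^ (-(1 + k - l)) := by
        rw [mul_left_comm, ← Real.rpow_add (by positivity)]; ring_nf
    _ ≤ _ := by
        gcongr (1 + 1 / c) ^ (1 + k) * ?_
        exact Real.rpow_le_rpow_of_nonpos (by positivity)
          (by simpa using abs_le_norm_vline c t) (by linarith)

theorem integrable_weight_vline {l k c : ℝ} (hl : 0 ≤ l) (hkl : l < k) (hc : 0 < c) :
    Integrable fun t : ℝ => (1 + ‖vline c t‖) ^ l * ‖vline c t‖ ^ (-(1 + k)) := by
  have h := (integrable_one_add_norm (E := ℝ) (μ := volume) (r := 1 + k - l)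
    -- The decay exponent `1 + k - l` exceeds one exactly because `k > l`.
    (by simp; linarith)).const_mul ((1 + 1 / c) ^ (1 + k))
  refine h.mono' (Continuous.aestronglyMeasurable ?_) (ae_of_all _ fun t => ?_)
  · refine Continuous.mul ?_ ?_
    · exact (continuous_const.add (continuous_vline c).norm).rpow_const fun t => Or.inr hl
    · exact (continuous_vline c).norm.rpow_const fun t => Or.inl (norm_vline_pos hc t).ne'
  · rw [Real.norm_of_nonneg (by positivity)]
    exact weight_vline_le hl hkl hc t

/-! ### The Laplace transform of a power and the Perron kernel. -/

/-- The Laplace transform of `t ^ p`. -/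
theorem integral_rpow_mul_cexp_neg {p : ℝ} (hp : -1 < p) {r : ℂ} (hr : 0 < r.re) :
    ∫ t in Ioi (0 : ℝ), ((t ^ p : ℝ) : ℂ) * cexp (-r * t) =
      Real.Gamma (p + 1) * r ^ ((-(1 + p) : ℝ) : ℂ) := by
  have hint : ∀ {q b : ℝ}, -1 < q → 0 < b →
      IntegrableOn (fun t : ℝ => t ^ q * Real.exp (-b * t)) (Ioi 0) := fun hq hb => by
    simpa using integrableOn_rpow_mul_exp_neg_mul_rpow hq one_pos hb
  have hmeas : ∀ (q : ℝ) (w : ℂ), AEStronglyMeasurable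
      (fun t : ℝ => ((t ^ q : ℝ) : ℂ) * cexp (-w * t)) (volume.restrict (Ioi 0)) := fun q w => by
    refine ContinuousOn.aestronglyMeasurable (fun t ht => ?_) measurableSet_Ioi
    refine ContinuousAt.continuousWithinAt ?_
    refine ContinuousAt.mul ?_ (by fun_prop)
    exact continuous_ofReal.continuousAt.comp (Real.continuousAt_rpow_const t q (Or.inl ht.out.ne'))
  have hnorm : ∀ (q : ℝ) (w : ℂ) {t : ℝ}, 0 < t →
      ‖((t ^ q : ℝ) : ℂ) * cexp (-w * t)‖ = t ^ q * Real.exp (-w.re * t) := fun q w t ht => by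
    rw [norm_mul, Complex.norm_exp, norm_real, Real.norm_of_nonneg (by positivity)]
    simp
  -- Identity theorem: both sides are holomorphic on the right half-plane and agree on the positive
  -- reals, where the integral is Euler's Gamma integral.
  set G : ℂ → ℂ := fun r => ∫ t in Ioi (0 : ℝ), ((t ^ p : ℝ) : ℂ) * cexp (-r * t)
  have hG : DifferentiableOn ℂ G (halfPlane 0) := by
    intro w hw
    have hw : 0 < w.re := hw
    refine (DifferentiableAt.differentiableWithinAt ?_)
    have h := hasDerivAt_integral_of_dominated_loc_of_deriv_le (μ := volume.restrict (Ioi (0 : ℝ)))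
      (F := fun (r : ℂ) (t : ℝ) => ((t ^ p : ℝ) : ℂ) * cexp (-r * t))
      (F' := fun (r : ℂ) (t : ℝ) => -(((t ^ (p + 1) : ℝ) : ℂ) * cexp (-r * t)))
      (x₀ := w) (s := halfPlane (w.re / 2))
      (bound := fun t => t ^ (p + 1) * Real.exp (-(w.re / 2) * t))
      ((isOpen_halfPlane _).mem_nhds (by simp [halfPlane]; linarith))
      (Eventually.of_forall fun r => hmeas p r)
      ((hint hp hw).mono' (hmeas p w) ?_) (hmeas (p + 1) w).neg ?_
      (hint (by linarith) (by linarith)) ?_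
    · exact h.2.differentiableAt
    · exact (ae_restrict_mem measurableSet_Ioi).mono fun t ht => (hnorm p w ht).le
    · refine (ae_restrict_mem measurableSet_Ioi).mono fun t ht r hr => ?_
      have ht : 0 < t := ht
      rw [norm_neg, hnorm _ _ ht]
      have : w.re / 2 < r.re := hr
      gcongr
    · refine (ae_restrict_mem measurableSet_Ioi).mono fun t ht r hr => ?_
      have ht : 0 < t := ht
      have h := (((hasDerivAt_id r).neg.mul_const (t : ℂ)).cexp).const_mul ((t ^ p : ℝ) : ℂ)
      refine h.congr_deriv ?_
      rw [Real.rpow_add_one ht.ne']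
      push_cast
      simp
      ring
  have hR : DifferentiableOn ℂ (fun r : ℂ => Real.Gamma (p + 1) * r ^ ((-(1 + p) : ℝ) : ℂ))
      (halfPlane 0) :=
    (differentiableOn_id.cpow (differentiableOn_const _) halfPlane_subset_slitPlane).const_mul _
  have hreal : ∀ x : ℝ, 0 < x →
      G x = Real.Gamma (p + 1) * (x : ℂ) ^ ((-(1 + p) : ℝ) : ℂ) := fun x hx => by
    have h := Real.integral_rpow_mul_exp_neg_mul_Ioi (a := p + 1) (by linarith) hx
    rw [← ofReal_cpow hx.le, Real.rpow_neg hx.le, ← Real.inv_rpow hx.le, ← ofReal_mul,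
      mul_comm, ← one_div, add_comm 1 p, ← h]
    refine Eq.trans ?_ integral_ofReal
    simp [G]
  refine (hG.analyticOnNhd (isOpen_halfPlane 0)).eqOn_of_preconnected_of_frequently_eq
    (hR.analyticOnNhd (isOpen_halfPlane 0)) (convex_halfPlane 0).isPreconnected
    (z₀ := 1) (by simp [halfPlane]) ?_ hr
  have hseq : Tendsto (fun x : ℝ => (x : ℂ)) (𝓝[≠] 1) (𝓝[≠] 1) := by
    refine tendsto_nhdsWithin_iff.2 ⟨?_, ?_⟩
    · exact (continuous_ofReal.tendsto' 1 1 (by simp)).mono_left nhdsWithin_le_nhds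
    · filter_upwards [self_mem_nhdsWithin] with x hx
      simpa using hx
  refine hseq.frequently (Eventually.frequently ?_)
  filter_upwards [nhdsWithin_le_nhds (Ioi_mem_nhds one_pos)] with x hx using hreal x hx

/-- The Perron kernel of order `p`: the inverse Laplace transform of `w ^ (-(1 + p))`. -/
theorem integral_cexp_mul_vline_cpow {p c : ℝ} (hp : 0 < p) (hc : 0 < c) (y : ℝ) :
    ∫ t : ℝ, cexp (y * vline c t) * vline c t ^ ((-(1 + p) : ℝ) : ℂ) =
      2 * Real.pi / Real.Gamma (p + 1) * ((max y 0 ^ p : ℝ) : ℂ) := by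
  have hΓ : (Real.Gamma (p + 1) : ℂ) ≠ 0 := by
    exact_mod_cast (Real.Gamma_pos_of_pos (by linarith)).ne'
  -- The exponentially damped truncated power has Fourier transform `Γ(p+1) w^{-(1+p)}` at `w = c +
  -- 2πiξ`. For `p > 0` this is integrable and `g` is continuous, so Fourier inversion applies at
  -- every point.
  set g : ℝ → ℂ := fun v => ((max v 0 ^ p : ℝ) : ℂ) * cexp (-c * v)
  have hgc : Continuous g := by
    refine Continuous.mul (continuous_ofReal.comp ?_) (by fun_prop)
    exact (continuous_id.max continuous_const).rpow_const fun v => Or.inr hp.le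
  have hgind : ∀ (w : ℂ), (fun v : ℝ => ((max v 0 ^ p : ℝ) : ℂ) * cexp (-w * v)) =
      (Ioi 0).indicator fun v : ℝ => ((v ^ p : ℝ) : ℂ) * cexp (-w * v) := fun w => by
    ext v
    by_cases hv : 0 < v
    · simp [hv, max_eq_left hv.le]
    · simp [hv, max_eq_right (not_lt.1 hv), Real.zero_rpow hp.ne']
  have hgi : Integrable g := by
    have h : IntegrableOn (fun t : ℝ => t ^ p * Real.exp (-c * t)) (Ioi 0) := by
      simpa using integrableOn_rpow_mul_exp_neg_mul_rpow (by linarith : -1 < p) one_pos hc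
    have : g = (Ioi 0).indicator fun v : ℝ => ((v ^ p * Real.exp (-c * v) : ℝ) : ℂ) := by
      rw [show g = _ from hgind c]; push_cast; rfl
    rw [this, integrable_indicator_iff measurableSet_Ioi]
    exact h.ofReal
  have hF : FourierTransform.fourier g = fun ξ : ℝ =>
      (Real.Gamma (p + 1) : ℂ) * vline c (2 * Real.pi * ξ) ^ ((-(1 + p) : ℝ) : ℂ) := by
    ext ξ
    rw [Real.fourier_real_eq_integral_exp_smul,
      ← integral_rpow_mul_cexp_neg (by linarith : -1 < p) (r := vline c (2 * Real.pi * ξ))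
        (by simpa using hc), ← integral_indicator measurableSet_Ioi, ← hgind]
    congr 1 with v
    simp only [g, smul_eq_mul]
    rw [mul_left_comm, ← Complex.exp_add]
    congr 2
    simp [vline]
    ring
  have hFi : Integrable (FourierTransform.fourier g) := by
    rw [hF]
    refine Integrable.const_mul ?_ _
    refine Integrable.comp_mul_left' (g := fun t => vline c t ^ ((-(1 + p) : ℝ) : ℂ)) ?_
      (by positivity)
    have h := integrable_weight_vline le_rfl hp hc
    refine h.mono' (continuous_vline_cpow hc _).aestronglyMeasurable (ae_of_all _ fun t => ?_)
    rw [norm_cpow_vline, Real.rpow_zero, one_mul]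
  have hinv := congrFun (hgc.fourierInv_fourier_eq hgi hFi) y
  rw [Real.fourierInv_eq', hF] at hinv
  have hsub := MeasureTheory.Measure.integral_comp_mul_left
    (fun t : ℝ => cexp (y * vline c t) * vline c t ^ ((-(1 + p) : ℝ) : ℂ)) (2 * Real.pi)
  have hrel : ∀ ξ : ℝ, cexp (y * vline c (2 * Real.pi * ξ)) *
      vline c (2 * Real.pi * ξ) ^ ((-(1 + p) : ℝ) : ℂ) =
      cexp (c * y) / Real.Gamma (p + 1) * (cexp (↑(2 * Real.pi * inner ℝ ξ y) * I) •
        ((Real.Gamma (p + 1) : ℂ) * vline c (2 * Real.pi * ξ) ^ ((-(1 + p) : ℝ) : ℂ))) := by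
    intro ξ
    have : cexp (y * vline c (2 * Real.pi * ξ)) =
        cexp (c * y) * cexp (↑(2 * Real.pi * inner ℝ ξ y) * I) := by
      rw [← Complex.exp_add]; congr 1; simp [vline]; ring
    rw [this, smul_eq_mul]
    field_simp
  simp_rw [hrel] at hsub
  rw [integral_const_mul, hinv, abs_of_pos (by positivity)] at hsub
  have h2 : ∫ t : ℝ, cexp (y * vline c t) * vline c t ^ ((-(1 + p) : ℝ) : ℂ) =
      (2 * Real.pi) * (cexp (c * y) / Real.Gamma (p + 1) * g y) := by
    rw [hsub, real_smul]
    push_cast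
    have : (Real.pi : ℂ) ≠ 0 := by exact_mod_cast Real.pi_ne_zero
    field_simp
  rw [h2]
  simp only [g]
  have he : cexp (c * y) * cexp (-c * y) = 1 := by rw [← Complex.exp_add]; simp
  linear_combination (2 * Real.pi / Real.Gamma (p + 1) * ((max y 0 ^ p : ℝ) : ℂ)) * he

/-! ### Perron integrals: dependence on `x` and on the abscissa. -/

/-- The integral of `g(w) e^{xw} w^{-(1+p)}` over the vertical line `[Re w = c]`. -/
def perronIntegral (g : ℂ → ℂ) (p c x : ℝ) : ℂ :=
  ∫ t : ℝ, g (vline c t) * (cexp (x * vline c t) * vline c t ^ ((-(1 + p) : ℝ) : ℂ))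

theorem norm_perron_integrand_le {g : ℂ → ℂ} {K l p c t : ℝ} (x : ℝ)
    (hg : ‖g (vline c t)‖ ≤ K * (1 + ‖vline c t‖) ^ l) :
    ‖g (vline c t) * (cexp (x * vline c t) * vline c t ^ ((-(1 + p) : ℝ) : ℂ))‖ ≤
      K * Real.exp (x * c) * ((1 + ‖vline c t‖) ^ l * ‖vline c t‖ ^ (-(1 + p))) := by
  rw [norm_mul, norm_mul, norm_cpow_vline, Complex.norm_exp]
  have : ((x : ℂ) * vline c t).re = x * c := by simp
  rw [this]
  calc _ ≤ K * (1 + ‖vline c t‖) ^ l * (Real.exp (x * c) * ‖vline c t‖ ^ (-(1 + p))) := by gcongr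
    _ = _ := by ring

theorem aestronglyMeasurable_perron_integrand {g : ℂ → ℂ} {c : ℝ} (hc : 0 < c) (x p : ℝ)
    (hg : AEStronglyMeasurable fun t => g (vline c t)) :
    AEStronglyMeasurable fun t : ℝ =>
      g (vline c t) * (cexp (x * vline c t) * vline c t ^ ((-(1 + p) : ℝ) : ℂ)) := by
  refine hg.mul (Continuous.aestronglyMeasurable ?_)
  exact Continuous.mul (by fun_prop) (continuous_vline_cpow hc _)

theorem integrable_perron_integrand {g : ℂ → ℂ} {K l p c : ℝ} (hl : 0 ≤ l) (hlp : l < p)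
    (hc : 0 < c) (x : ℝ) (hg : AEStronglyMeasurable fun t => g (vline c t))
    (hgb : ∀ t, ‖g (vline c t)‖ ≤ K * (1 + ‖vline c t‖) ^ l) :
    Integrable fun t : ℝ =>
      g (vline c t) * (cexp (x * vline c t) * vline c t ^ ((-(1 + p) : ℝ) : ℂ)) :=
  ((integrable_weight_vline hl hlp hc).const_mul _).mono'
    (aestronglyMeasurable_perron_integrand hc x p hg)
    (ae_of_all _ fun t => norm_perron_integrand_le x (hgb t))

/-- Differentiating `e^{xw}` produces a factor `w`, which lowers the order by one; the new integrand
is still dominated because `p > l`. -/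
theorem hasDerivAt_perronIntegral {g : ℂ → ℂ} {K l p c : ℝ} (hl : 0 ≤ l) (hlp : l < p)
    (hc : 0 < c) (hg : AEStronglyMeasurable fun t => g (vline c t))
    (hgb : ∀ t, ‖g (vline c t)‖ ≤ K * (1 + ‖vline c t‖) ^ l) (x : ℝ) :
    HasDerivAt (perronIntegral g (p + 1) c) (perronIntegral g p c x) x := by
  have hK : 0 ≤ K := by
    have h := (norm_nonneg _).trans (hgb 0)
    exact nonneg_of_mul_nonneg_left h (by positivity)
  refine (hasDerivAt_integral_of_dominated_loc_of_deriv_le (μ := volume)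
    (F := fun (x : ℝ) (t : ℝ) =>
      g (vline c t) * (cexp (x * vline c t) * vline c t ^ ((-(1 + (p + 1)) : ℝ) : ℂ)))
    (F' := fun (x : ℝ) (t : ℝ) =>
      g (vline c t) * (cexp (x * vline c t) * vline c t ^ ((-(1 + p) : ℝ) : ℂ)))
    (s := Iio (x + 1))
    (bound := fun t => K * Real.exp ((x + 1) * c) *
      ((1 + ‖vline c t‖) ^ l * ‖vline c t‖ ^ (-(1 + p))))
    (Iio_mem_nhds (by linarith))
    (Eventually.of_forall fun y => aestronglyMeasurable_perron_integrand hc y _ hg)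
    (integrable_perron_integrand hl (by linarith) hc x hg hgb)
    (aestronglyMeasurable_perron_integrand hc x _ hg) ?_
    ((integrable_weight_vline hl hlp hc).const_mul _) ?_).2
  · refine ae_of_all _ fun t y hy => (norm_perron_integrand_le y (hgb t)).trans ?_
    have : y ≤ x + 1 := hy.out.le
    gcongr
  · refine ae_of_all _ fun t y _ => ?_
    have hne : vline c t ≠ 0 := norm_pos_iff.1 (norm_vline_pos hc t)
    have h := ((((hasDerivAt_id (y : ℂ)).comp_ofReal).mul_const (vline c t)).cexp.mul_const
      (vline c t ^ ((-(1 + (p + 1)) : ℝ) : ℂ))).const_mul (g (vline c t))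
    refine h.congr_deriv ?_
    have : vline c t ^ ((-(1 + p) : ℝ) : ℂ) =
        vline c t ^ ((-(1 + (p + 1)) : ℝ) : ℂ) * vline c t := by
      rw [show ((-(1 + p) : ℝ) : ℂ) = ((-(1 + (p + 1)) : ℝ) : ℂ) + 1 by push_cast; ring,
        cpow_add _ _ hne, cpow_one]
    rw [this, id_eq]
    ring

/-- Independence of an absolutely convergent vertical integral of the abscissa. -/
theorem integral_vline_eq_of_decay {h : ℂ → ℂ} {c₁ c₂ : ℝ} (hc : c₁ ≤ c₂)
    (hd : DifferentiableOn ℂ h {z | c₁ ≤ z.re}) (h₁ : Integrable fun t => h (vline c₁ t))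
    (h₂ : Integrable fun t => h (vline c₂ t)) {B : ℝ → ℝ} (hB : Tendsto B atTop (𝓝 0))
    (hhB : ∀ σ ∈ Icc c₁ c₂, ∀ t, ‖h (vline σ t)‖ ≤ B |t|) :
    ∫ t, h (vline c₁ t) = ∫ t, h (vline c₂ t) := by
  -- Cauchy's theorem on the rectangle of height `2T`; the horizontal sides are bounded by `B T`
  -- times the width and vanish in the limit.
  have hrect : ∀ T : ℝ, (∫ x in c₁..c₂, h (vline x (-T))) - (∫ x in c₁..c₂, h (vline x T)) +
      I • (∫ y in (-T)..T, h (vline c₂ y)) - I • (∫ y in (-T)..T, h (vline c₁ y)) = 0 := by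
    intro T
    have := Complex.integral_boundary_rect_eq_zero_of_differentiableOn h (vline c₁ (-T))
      (vline c₂ T) (hd.mono fun z hz => ?_)
    · simp only [vline_re, vline_im] at this
      exact this
    · have := (mem_reProdIm.1 hz).1
      rw [vline_re, vline_re, uIcc_of_le hc] at this
      exact this.1
  have hhor : ∀ s : ℝ → ℝ, (∀ T, 0 ≤ T → |s T| = T) →
      Tendsto (fun T => ∫ x in c₁..c₂, h (vline x (s T))) atTop (𝓝 0) := by
    intro s hs
    refine squeeze_zero_norm' (a := fun T => B T * |c₂ - c₁|) ?_ (by simpa using hB.mul_const _)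
    filter_upwards [eventually_ge_atTop 0] with T hT
    refine intervalIntegral.norm_integral_le_of_norm_le_const fun x hx => ?_
    rw [uIoc_of_le hc] at hx
    exact (hhB x ⟨hx.1.le, hx.2⟩ (s T)).trans_eq (by rw [hs T hT])
  have l₁ := intervalIntegral_tendsto_integral h₁ tendsto_neg_atTop_atBot tendsto_id
  have l₂ := intervalIntegral_tendsto_integral h₂ tendsto_neg_atTop_atBot tendsto_id
  have hlim := (((hhor (fun T => -T) fun T hT => by simp [abs_of_nonneg hT]).sub
    (hhor (fun T => T) fun T hT => abs_of_nonneg hT)).add (l₂.const_smul I)).sub (l₁.const_smul I)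
  have hz := tendsto_nhds_unique hlim (tendsto_const_nhds.congr fun T => (hrect T).symm)
  have : I * ((∫ t, h (vline c₂ t)) - ∫ t, h (vline c₁ t)) = 0 := by
    rw [← hz]; simp only [smul_eq_mul]; ring
  rcases mul_eq_zero.1 this with h | h
  · exact absurd h I_ne_zero
  · exact (sub_eq_zero.1 h).symm

theorem continuous_comp_vline {g : ℂ → ℂ} (hg : DifferentiableOn ℂ g (halfPlane 0)) {c : ℝ}
    (hc : 0 < c) : Continuous fun t => g (vline c t) :=
  hg.continuousOn.comp_continuous (continuous_vline c) fun t => by simpa [halfPlane] using hc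

theorem perronIntegral_eq_of_le {g : ℂ → ℂ} {K l p c₁ c₂ : ℝ} (hl : 0 ≤ l) (hlp : l < p)
    (hg : DifferentiableOn ℂ g (halfPlane 0))
    (hgb : ∀ w ∈ halfPlane 0, ‖g w‖ ≤ K * (1 + ‖w‖) ^ l) (hc₁ : 0 < c₁) (hc : c₁ ≤ c₂) (x : ℝ) :
    perronIntegral g p c₁ x = perronIntegral g p c₂ x := by
  have hc₂ := hc₁.trans_le hc
  have hK : 0 ≤ K := by
    have h := (norm_nonneg _).trans (hgb 1 (by simp [halfPlane]))
    exact nonneg_of_mul_nonneg_left h (by positivity)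
  have hgl : ∀ {c : ℝ}, 0 < c → ∀ t, ‖g (vline c t)‖ ≤ K * (1 + ‖vline c t‖) ^ l :=
    fun hc t => hgb _ (by simpa [halfPlane] using hc)
  refine integral_vline_eq_of_decay
    (h := fun w => g w * (cexp (x * w) * w ^ ((-(1 + p) : ℝ) : ℂ)))
    (B := fun T => K * Real.exp (|x| * c₂) * ((1 + 1 / c₁) ^ (1 + p) * (1 + T) ^ (-(1 + p - l))))
    hc ?_ ?_ ?_ ?_ ?_
  · have hsub : {z : ℂ | c₁ ≤ z.re} ⊆ halfPlane 0 := fun z hz => hc₁.trans_le hz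
    refine (hg.mono hsub).mul (DifferentiableOn.mul (by fun_prop) ?_)
    exact differentiableOn_id.cpow (differentiableOn_const _)
      fun z hz => halfPlane_subset_slitPlane (hsub hz)
  · exact integrable_perron_integrand hl hlp hc₁ x
      (continuous_comp_vline hg hc₁).aestronglyMeasurable (hgl hc₁)
  · exact integrable_perron_integrand hl hlp hc₂ x
      (continuous_comp_vline hg hc₂).aestronglyMeasurable (hgl hc₂)
  · have h1 := (tendsto_rpow_neg_atTop (y := 1 + p - l) (by linarith)).comp
      (tendsto_atTop_add_const_left atTop (1 : ℝ) tendsto_id)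
    simpa using (h1.const_mul ((1 + 1 / c₁) ^ (1 + p))).const_mul (K * Real.exp (|x| * c₂))
  · intro σ hσ t
    have hσ0 := hc₁.trans_le hσ.1
    refine (norm_perron_integrand_le x (hgl hσ0 t)).trans ?_
    refine mul_le_mul ?_ ((weight_vline_le hl hlp hσ0 t).trans ?_) (by positivity) (by positivity)
    · have : x * σ ≤ |x| * c₂ := mul_le_mul (le_abs_self x) hσ.2 hσ0.le (abs_nonneg x)
      gcongr
    · rw [Real.norm_eq_abs]
      have h := hσ.1
      have : 0 ≤ 1 + p := by linarith
      gcongr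

/-! ### Perron sums and lowering the order. -/

/-- The sum `∑_{λ_n < x} a_n (x - λ_n)^p`. -/
def perronSum (lam : Frequency) (p : ℝ) (a : ℕ → ℂ) (x : ℝ) : ℂ :=
  ∑ n ∈ lam.below x, a n * (((x - lam.seq n) ^ p : ℝ) : ℂ)

theorem mem_below {lam : Frequency} {x : ℝ} {n : ℕ} : n ∈ lam.below x ↔ lam.seq n < x := by
  simp [Frequency.below]

theorem below_mono (lam : Frequency) {x y : ℝ} (h : x ≤ y) : lam.below x ⊆ lam.below y :=
  fun _ hn => mem_below.2 ((mem_below.1 hn).trans_le h)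

/-- Truncated powers vanish beyond the cut-off, so the index set can be frozen while `x` varies;
this is what makes the sum accessible to calculus. -/
theorem perronSum_eq {lam : Frequency} {p : ℝ} (hp : 0 < p) (a : ℕ → ℂ) {x : ℝ} {s : Finset ℕ}
    (hs : lam.below x ⊆ s) :
    perronSum lam p a x = ∑ n ∈ s, a n * ((max (x - lam.seq n) 0 ^ p : ℝ) : ℂ) := by
  rw [← Finset.sum_subset hs]
  · refine Finset.sum_congr rfl fun n hn => ?_
    rw [max_eq_left (sub_nonneg.2 (mem_below.1 hn).le)]
  · intro n _ hn
    rw [mem_below, not_lt] at hn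
    rw [max_eq_right (sub_nonpos.2 hn), Real.zero_rpow hp.ne']
    simp

/-- Only the corner at zero needs care: there the difference quotient is itself `max t 0 ^ p`, which
tends to zero as `p > 0`. -/
theorem hasDerivAt_max_rpow {p : ℝ} (hp : 0 < p) (y : ℝ) :
    HasDerivAt (fun y : ℝ => max y 0 ^ (p + 1)) ((p + 1) * max y 0 ^ p) y := by
  have hp1 : p + 1 ≠ 0 := by linarith
  rcases lt_trichotomy y 0 with hy | rfl | hy
  · rw [max_eq_right hy.le, Real.zero_rpow hp.ne', mul_zero]
    refine (hasDerivAt_const y (0 : ℝ)).congr_of_eventuallyEq ?_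
    filter_upwards [Iio_mem_nhds hy] with z hz
    rw [max_eq_right hz.out.le, Real.zero_rpow hp1]
  · rw [hasDerivAt_iff_tendsto_slope_zero]
    have hc : Tendsto (fun t : ℝ => max t 0 ^ p) (𝓝 0) (𝓝 0) := by
      have : Continuous fun t : ℝ => max t 0 ^ p :=
        (continuous_id.max continuous_const).rpow_const fun v => Or.inr hp.le
      exact this.tendsto' 0 0 (by simp [Real.zero_rpow hp.ne'])
    simp only [max_self, Real.zero_rpow hp.ne', mul_zero]
    refine (hc.mono_left nhdsWithin_le_nhds).congr' ?_
    filter_upwards [self_mem_nhdsWithin] with t ht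
    have ht : t ≠ 0 := ht
    rw [zero_add, Real.zero_rpow hp1, sub_zero, smul_eq_mul]
    rcases le_or_gt t 0 with h | h
    · rw [max_eq_right h, Real.zero_rpow hp.ne', Real.zero_rpow hp1, mul_zero]
    · rw [max_eq_left h.le, Real.rpow_add_one ht]
      field_simp
  · rw [max_eq_left hy.le]
    have h := Real.hasDerivAt_rpow_const (x := y) (p := p + 1) (Or.inl hy.ne')
    rw [add_sub_cancel_right] at h
    refine h.congr_of_eventuallyEq ?_
    filter_upwards [Ioi_mem_nhds hy] with z hz
    rw [max_eq_left hz.out.le]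

theorem hasDerivAt_perronSum (lam : Frequency) {p : ℝ} (hp : 0 < p) (a : ℕ → ℂ) (x : ℝ) :
    HasDerivAt (perronSum lam (p + 1) a) ((p + 1) * perronSum lam p a x) x := by
  have heq : perronSum lam (p + 1) a =ᶠ[𝓝 x] fun y =>
      ∑ n ∈ lam.below (x + 1), a n * ((max (y - lam.seq n) 0 ^ (p + 1) : ℝ) : ℂ) := by
    filter_upwards [Iio_mem_nhds (show x < x + 1 by linarith)] with y hy
    exact perronSum_eq (by linarith) a (below_mono lam hy.out.le)
  refine HasDerivAt.congr_of_eventuallyEq ?_ heq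
  rw [perronSum_eq hp a (below_mono lam (show x ≤ x + 1 by linarith)), Finset.mul_sum]
  refine HasDerivAt.fun_sum fun n _ => ?_
  have h := (((hasDerivAt_max_rpow hp (x - lam.seq n)).comp x
    ((hasDerivAt_id x).sub_const (lam.seq n))).ofReal_comp).const_mul (a n)
  refine h.congr_deriv ?_
  push_cast
  ring

/-- A Perron formula of order `p + 1` implies the one of order `p`. -/
theorem perron_formula_of_succ {lam : Frequency} {a : ℕ → ℂ} {g : ℂ → ℂ} {K l p c : ℝ}
    (hl : 0 ≤ l) (hlp : l < p) (hc : 0 < c) (hg : AEStronglyMeasurable fun t => g (vline c t))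
    (hgb : ∀ t, ‖g (vline c t)‖ ≤ K * (1 + ‖vline c t‖) ^ l)
    (h : ∀ x, perronIntegral g (p + 1) c x =
      2 * Real.pi / Real.Gamma (p + 1 + 1) * perronSum lam (p + 1) a x) (x : ℝ) :
    perronIntegral g p c x = 2 * Real.pi / Real.Gamma (p + 1) * perronSum lam p a x := by
  have h1 := hasDerivAt_perronIntegral hl hlp hc hg hgb x
  rw [funext h] at h1
  have h2 := (hasDerivAt_perronSum lam (hl.trans_lt hlp) a x).const_mul
    (2 * Real.pi / Real.Gamma (p + 1 + 1) : ℂ)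
  rw [h1.unique h2, Real.Gamma_add_one (by linarith)]
  have hΓ : (Real.Gamma (p + 1) : ℂ) ≠ 0 := by
    exact_mod_cast (Real.Gamma_pos_of_pos (by linarith)).ne'
  have hp : (p : ℂ) + 1 ≠ 0 := by
    exact_mod_cast (by linarith : p + 1 ≠ 0)
  push_cast
  field_simp

/-! ### Translated coefficients and raising the order of summability. -/

/-- The coefficients `a_n e^{-λ_n s}` of the translate by `s`. -/
def twist (lam : Frequency) (a : ℕ → ℂ) (s : ℂ) (n : ℕ) : ℂ := a n * cexp (-(lam.seq n : ℂ) * s)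

theorem rieszMean_add (lam : Frequency) (k : ℝ) (a : ℕ → ℂ) (x : ℝ) (s w : ℂ) :
    rieszMean lam k a x (s + w) = rieszMean lam k (twist lam a s) x w := by
  refine Finset.sum_congr rfl fun n _ => ?_
  rw [twist, mul_add, Complex.exp_add]
  ring

theorem one_sub_div_mem {lam : Frequency} {x : ℝ} (hx : 0 < x) {n : ℕ} (hn : n ∈ lam.below x) :
    1 - lam.seq n / x ∈ Ioc (0 : ℝ) 1 := by
  have h1 := mem_below.1 hn
  have h2 : lam.seq n / x < 1 := (div_lt_one hx).2 h1
  have h3 : 0 ≤ lam.seq n / x := div_nonneg (lam.nonneg n) hx.le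
  constructor <;> linarith

/-- Convergence bounds the means for large `x`; the remaining `x` involve finitely many terms, with
factors `(1 - λ_n / x)^m` at most one. -/
theorem exists_norm_rieszMean_le {lam : Frequency} {m : ℝ} (hm : 0 ≤ m) {a : ℕ → ℂ} {s A : ℂ}
    (h : Tendsto (fun x => rieszMean lam m a x s) atTop (𝓝 A)) :
    ∃ C, 0 ≤ C ∧ ∀ x, 0 < x → ‖rieszMean lam m a x s‖ ≤ C := by
  obtain ⟨X, hX⟩ := eventually_atTop.1
    (h.norm.eventually (gt_mem_nhds (show ‖A‖ < ‖A‖ + 1 by linarith)))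
  set S := ∑ n ∈ lam.below X, ‖a n * cexp (-(lam.seq n : ℂ) * s)‖ with hS
  have hS0 : 0 ≤ S := Finset.sum_nonneg fun _ _ => norm_nonneg _
  refine ⟨‖A‖ + 1 + S, by positivity, fun x hx => ?_⟩
  rcases le_total X x with hXx | hXx
  · linarith [hX x hXx]
  · refine (norm_sum_le _ _).trans ?_
    refine le_trans (Finset.sum_le_sum (g := fun n => ‖a n * cexp (-(lam.seq n : ℂ) * s)‖) ?_) ?_
    · intro n hn
      obtain ⟨h0, h1⟩ := one_sub_div_mem hx hn
      rw [norm_mul, norm_real, Real.norm_of_nonneg (by positivity)]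
      exact mul_le_of_le_one_right (norm_nonneg _) (Real.rpow_le_one h0.le h1 hm)
    · have := Finset.sum_le_sum_of_subset_of_nonneg (below_mono lam hXx)
        (f := fun n => ‖a n * cexp (-(lam.seq n : ℂ) * s)‖) fun _ _ _ => norm_nonneg _
      linarith [norm_nonneg A]

/-- The kernel `t ↦ (t - μ)_+^m (1 - t)^q`. -/
def betaKernel (m q μ t : ℝ) : ℝ := (Ioi μ).indicator (fun t => (t - μ) ^ m * (1 - t) ^ q) t

theorem intervalIntegrable_betaKernel {m q : ℝ} (hm : 0 ≤ m) (hq : 0 ≤ q) (μ a b : ℝ) :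
    IntervalIntegrable (betaKernel m q μ) volume a b := by
  have hc : Continuous fun t : ℝ => (t - μ) ^ m * (1 - t) ^ q :=
    ((continuous_id.sub continuous_const).rpow_const fun _ => Or.inr hm).mul
      ((continuous_const.sub continuous_id).rpow_const fun _ => Or.inr hq)
  have := hc.intervalIntegrable (μ := volume) a b
  rw [intervalIntegrable_iff] at this ⊢
  exact this.indicator measurableSet_Ioi

/-- The affine substitution `t = μ + (1 - μ) s` maps `[0, 1]` onto `[μ, 1]` and pulls out all powers
of `1 - μ`. -/
theorem integral_betaKernel {m q μ : ℝ} (hm : 0 ≤ m) (hq : 0 ≤ q) (h0 : 0 ≤ μ) (h1 : μ < 1) :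
    ∫ t in (0 : ℝ)..1, betaKernel m q μ t =
      (1 - μ) ^ (m + q + 1) * ∫ t in (0 : ℝ)..1, betaKernel m q 0 t := by
  have hμ : ∀ μ : ℝ, 0 ≤ μ → μ < 1 → ∫ t in (0 : ℝ)..1, betaKernel m q μ t =
      ∫ t in μ..1, (t - μ) ^ m * (1 - t) ^ q := by
    intro μ h0 h1
    rw [← intervalIntegral.integral_add_adjacent_intervals
      (intervalIntegrable_betaKernel hm hq μ 0 μ) (intervalIntegrable_betaKernel hm hq μ μ 1)]
    have hz : ∫ t in (0 : ℝ)..μ, betaKernel m q μ t = 0 := by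
      rw [intervalIntegral.integral_congr (g := fun _ => 0)]
      · simp
      · intro t ht
        rw [uIcc_of_le h0] at ht
        simp [betaKernel, ht.2]
    rw [hz, zero_add]
    refine intervalIntegral.integral_congr_ae (ae_of_all _ fun t ht => ?_)
    rw [uIoc_of_le h1.le] at ht
    simp [betaKernel, ht.1]
  have hd : 0 < 1 - μ := by linarith
  rw [hμ μ h0 h1, hμ 0 le_rfl one_pos]
  have h := intervalIntegral.integral_comp_add_mul (a := 0) (b := 1)
    (fun t : ℝ => (t - μ) ^ m * (1 - t) ^ q) hd.ne' μ
  rw [mul_zero, mul_one, add_zero, add_sub_cancel, smul_eq_mul, eq_inv_mul_iff_mul_eq₀ hd.ne'] at h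
  rw [← h, ← intervalIntegral.integral_const_mul, ← intervalIntegral.integral_const_mul]
  refine intervalIntegral.integral_congr fun t ht => ?_
  rw [uIcc_of_le zero_le_one] at ht
  have e1 : μ + (1 - μ) * t - μ = (1 - μ) * t := by ring
  have e2 : 1 - (μ + (1 - μ) * t) = (1 - μ) * (1 - t) := by ring
  simp only [e1, e2, sub_zero]
  rw [Real.mul_rpow hd.le ht.1, Real.mul_rpow hd.le (by linarith [ht.2]),
    Real.rpow_add hd, Real.rpow_add hd, Real.rpow_one]
  ring

theorem integral_betaKernel_zero_pos {m q : ℝ} (hm : 0 ≤ m) (hq : 0 ≤ q) :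
    0 < ∫ t in (0 : ℝ)..1, betaKernel m q 0 t := by
  refine intervalIntegral.intervalIntegral_pos_of_pos_on
    (intervalIntegrable_betaKernel hm hq 0 0 1) (fun t ht => ?_) one_pos
  have h1 : 0 < t := ht.1
  have h2 : 0 < 1 - t := by linarith [ht.2]
  simp only [betaKernel, mem_Ioi, h1, indicator_of_mem, sub_zero]
  positivity

/-- The factor `t^m` turns `(1 - λ_n / (xt))^m` into `(t - λ_n / x)^m`. Integrating over `t` thus
exhibits the mean of order `m + q + 1` as a beta average of means of order `m`. -/
theorem rieszMean_mul_betaKernel (lam : Frequency) {m : ℝ} (q : ℝ) (a : ℕ → ℂ)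
    (s : ℂ) {x t : ℝ} (hx : 0 < x) (ht0 : 0 < t) (ht1 : t ≤ 1) :
    rieszMean lam m a (x * t) s * betaKernel m q 0 t =
      ∑ n ∈ lam.below x,
        a n * cexp (-(lam.seq n : ℂ) * s) * betaKernel m q (lam.seq n / x) t := by
  have hsub : lam.below (x * t) ⊆ lam.below x := below_mono lam (mul_le_of_le_one_right hx.le ht1)
  rw [rieszMean, Finset.sum_mul, ← Finset.sum_subset hsub]
  · refine Finset.sum_congr rfl fun n hn => ?_
    have hlt := mem_below.1 hn
    have h1 : lam.seq n / x < t := by rwa [div_lt_iff₀' hx]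
    have h2 := one_sub_div_mem (mul_pos hx ht0) hn
    simp only [betaKernel, mem_Ioi, ht0, indicator_of_mem, sub_zero, h1]
    rw [mul_assoc]
    congr 1
    norm_cast
    rw [← mul_assoc, ← Real.mul_rpow h2.1.le ht0.le]
    congr 2
    field_simp
  · intro n _ hn
    rw [mem_below, not_lt] at hn
    have h1 : ¬ lam.seq n / x < t := by
      rw [not_lt, le_div_iff₀ hx]; linarith
    simp [betaKernel, h1]

/-- Riesz summability of order `m` implies Riesz summability of order `m + q + 1`, with the
same limit. -/
theorem tendsto_rieszMean_of_order_le {lam : Frequency} {m q : ℝ} (hm : 0 ≤ m) (hq : 0 ≤ q)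
    {a : ℕ → ℂ} {s A : ℂ} (h : Tendsto (fun x => rieszMean lam m a x s) atTop (𝓝 A)) :
    Tendsto (fun x => rieszMean lam (m + q + 1) a x s) atTop (𝓝 A) := by
  set β := ∫ t in (0 : ℝ)..1, betaKernel m q 0 t with hβ
  have hβ0 : (β : ℂ) ≠ 0 := by exact_mod_cast (integral_betaKernel_zero_pos hm hq).ne'
  obtain ⟨C, hC0, hC⟩ := exists_norm_rieszMean_le hm h
  have hii : ∀ μ : ℝ, IntervalIntegrable (fun t => (betaKernel m q μ t : ℂ)) volume 0 1 :=
    fun μ => ⟨(intervalIntegrable_betaKernel hm hq μ 0 1).1.ofReal,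
      (intervalIntegrable_betaKernel hm hq μ 0 1).2.ofReal⟩
  have hcongr : ∀ {x : ℝ}, 0 < x → ∀ t ∈ uIoc (0 : ℝ) 1,
      ∑ n ∈ lam.below x, a n * cexp (-(lam.seq n : ℂ) * s) * betaKernel m q (lam.seq n / x) t =
      rieszMean lam m a (x * t) s * betaKernel m q 0 t := by
    intro x hx t ht
    rw [uIoc_of_le zero_le_one] at ht
    exact (rieszMean_mul_betaKernel lam q a s hx ht.1 ht.2).symm
  have hsum : ∀ {x : ℝ}, 0 < x → IntervalIntegrable (fun t => ∑ n ∈ lam.below x,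
      a n * cexp (-(lam.seq n : ℂ) * s) * betaKernel m q (lam.seq n / x) t) volume 0 1 := by
    intro x hx
    have := IntervalIntegrable.sum (lam.below x) (f := fun n t =>
      a n * cexp (-(lam.seq n : ℂ) * s) * (betaKernel m q (lam.seq n / x) t : ℂ))
      (a := 0) (b := 1) (μ := volume) fun n _ => (hii _).const_mul _
    simpa only [Finset.sum_fn] using this
  have hmean : ∀ {x : ℝ}, 0 < x → ∫ t in (0 : ℝ)..1, rieszMean lam m a (x * t) s *
      betaKernel m q 0 t = β * rieszMean lam (m + q + 1) a x s := by
    intro x hx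
    rw [← intervalIntegral.integral_congr_ae (ae_of_all _ (hcongr hx)),
      intervalIntegral.integral_finsetSum fun n _ => (hii _).const_mul _, rieszMean,
      Finset.mul_sum]
    refine Finset.sum_congr rfl fun n hn => ?_
    have h0 : 0 ≤ lam.seq n / x := div_nonneg (lam.nonneg n) hx.le
    have h1 : lam.seq n / x < 1 := (div_lt_one hx).2 (mem_below.1 hn)
    rw [intervalIntegral.integral_const_mul, intervalIntegral.integral_ofReal,
      integral_betaKernel hm hq h0 h1, ← hβ]
    push_cast
    ring
  have hlim : Tendsto (fun x : ℝ => ∫ t in (0 : ℝ)..1, rieszMean lam m a (x * t) s *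
      betaKernel m q 0 t) atTop (𝓝 (∫ t in (0 : ℝ)..1, A * betaKernel m q 0 t)) := by
    refine intervalIntegral.tendsto_integral_filter_of_dominated_convergence
      (fun t => C * ‖betaKernel m q 0 t‖) ?_ ?_
      ((intervalIntegrable_betaKernel hm hq 0 0 1).norm.const_mul C) ?_
    · filter_upwards [eventually_gt_atTop 0] with x hx
      refine ((intervalIntegrable_iff.1 (hsum hx)).congr ?_).aestronglyMeasurable
      exact (ae_restrict_mem measurableSet_uIoc).mono (hcongr hx)
    · filter_upwards [eventually_gt_atTop 0] with x hx
      refine ae_of_all _ fun t ht => ?_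
      rw [uIoc_of_le zero_le_one] at ht
      rw [norm_mul, norm_real]
      gcongr
      exact hC _ (mul_pos hx ht.1)
    · refine ae_of_all _ fun t ht => ?_
      rw [uIoc_of_le zero_le_one] at ht
      exact (h.comp (tendsto_id.atTop_mul_const ht.1)).mul_const _
  rw [intervalIntegral.integral_const_mul, intervalIntegral.integral_ofReal, ← hβ] at hlim
  have := (hlim.congr' (by
    filter_upwards [eventually_gt_atTop 0] with x hx using hmean hx)).const_mul (β : ℂ)⁻¹
  simpa [hβ0, mul_comm A] using this

/-! ### Polynomial bounds for Riesz means on a vertical line. -/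

theorem iteratedDeriv_cexp_ofReal_mul (w : ℂ) (j : ℕ) :
    iteratedDeriv j (fun τ : ℝ => cexp (τ * w)) = fun τ : ℝ => w ^ j * cexp (τ * w) := by
  induction j with
  | zero => simp
  | succ j ih =>
    rw [iteratedDeriv_succ, ih]
    ext τ
    have h := (((hasDerivAt_id (τ : ℂ)).comp_ofReal.mul_const w).cexp).const_mul (w ^ j)
    refine (h.congr_deriv ?_).deriv
    simp only [id_eq]
    ring

theorem contDiff_cexp_ofReal_mul (w : ℂ) {n : WithTop ℕ∞} :
    ContDiff ℝ n fun τ : ℝ => cexp (τ * w) :=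
  (ofRealCLM.contDiff.mul contDiff_const).cexp

theorem iteratedDeriv_pow_smul_cexp (N j : ℕ) (w : ℂ) (τ : ℝ) :
    iteratedDeriv j ((fun τ : ℝ => τ ^ N) • fun τ : ℝ => cexp (τ * w)) τ =
      ∑ i ∈ Finset.range (j + 1), j.choose i • (N.descFactorial i * τ ^ (N - i)) •
        (w ^ (j - i) * cexp (τ * w)) := by
  have h := iteratedDerivWithin_smul (n := j) (mem_univ τ) uniqueDiffOn_univ
    (f := fun τ : ℝ => τ ^ N) (g := fun τ : ℝ => cexp (τ * w))
    (contDiff_id.pow N).contDiffAt.contDiffWithinAt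
    (contDiff_cexp_ofReal_mul w).contDiffAt.contDiffWithinAt
  simp only [iteratedDerivWithin_univ, iteratedDeriv_pow, iteratedDeriv_cexp_ofReal_mul] at h
  exact h

theorem norm_iteratedDeriv_pow_smul_cexp_le (N : ℕ) :
    ∃ E : ℝ, 0 ≤ E ∧ ∀ (w : ℂ) (τ : ℝ), 0 ≤ τ →
      ‖iteratedDeriv (N + 1) ((fun τ : ℝ => τ ^ N) • fun τ : ℝ => cexp (τ * w)) τ‖ ≤
        E * (1 + ‖w‖) ^ (N + 1) * (1 + τ) ^ N * Real.exp (τ * w.re) := by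
  refine ⟨∑ i ∈ Finset.range (N + 2), ((N + 1).choose i * N.descFactorial i : ℝ), by positivity,
    fun w τ hτ => ?_⟩
  rw [iteratedDeriv_pow_smul_cexp]
  refine (norm_sum_le _ _).trans ?_
  rw [Finset.sum_mul, Finset.sum_mul, Finset.sum_mul]
  refine Finset.sum_le_sum fun i _ => ?_
  rw [← Nat.cast_smul_eq_nsmul ℝ, norm_smul, norm_smul, norm_mul (w ^ _),
    norm_pow w, Complex.norm_exp, Real.norm_of_nonneg (by positivity),
    Real.norm_of_nonneg (by positivity)]
  have h1 : ‖w‖ ^ (N + 1 - i) ≤ (1 + ‖w‖) ^ (N + 1) :=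
    (pow_le_pow_left₀ (norm_nonneg w) (by linarith) _).trans
      (pow_le_pow_right₀ (by linarith [norm_nonneg w]) (by omega))
  have h2 : τ ^ (N - i) ≤ (1 + τ) ^ N :=
    (pow_le_pow_left₀ hτ (by linarith) _).trans (pow_le_pow_right₀ (by linarith) (by omega))
  have h3 : ((τ : ℂ) * w).re = τ * w.re := by simp
  rw [h3]
  calc _ ≤ ((N + 1).choose i : ℝ) * ((N.descFactorial i * (1 + τ) ^ N) *
        ((1 + ‖w‖) ^ (N + 1) * Real.exp (τ * w.re))) := by gcongr
    _ = _ := by ring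

/-- Taylor's formula of degree `N` at zero for `τ^N e^{τw}`, in integral form. -/
theorem pow_mul_cexp_eq_add_integral (N : ℕ) (w : ℂ) {v : ℝ} (hv : 0 < v) :
    ((v ^ N : ℝ) : ℂ) * cexp (v * w) = ((v ^ N : ℝ) : ℂ) + ∫ τ in (0 : ℝ)..v,
      (((v - τ) ^ N : ℝ) : ℂ) * ((N.factorial : ℂ)⁻¹ *
        iteratedDeriv (N + 1) ((fun τ : ℝ => τ ^ N) • fun τ : ℝ => cexp (τ * w)) τ) := by
  set h : ℝ → ℂ := (fun τ : ℝ => τ ^ N) • fun τ : ℝ => cexp (τ * w) with hh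
  have hcd : ∀ {n : WithTop ℕ∞}, ContDiff ℝ n h :=
    (contDiff_id.pow N).smul (contDiff_cexp_ofReal_mul w)
  have hu : UniqueDiffOn ℝ (uIcc 0 v) := uniqueDiffOn_uIcc hv.ne
  have hT := taylor_integral_remainder (f := h) (x := v) (x₀ := 0) (n := N) hcd.contDiffOn
  -- By Leibniz, every term that keeps a positive power of `τ` dies at zero; only the `N`-th
  -- derivative survives, with all derivatives falling on `τ^N`.
  have hpoly : taylorWithinEval h N (uIcc 0 v) 0 v = ((v ^ N : ℝ) : ℂ) := by
    rw [taylor_within_apply, Finset.sum_range_succ, Finset.sum_eq_zero, zero_add]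
    · rw [iteratedDerivWithin_eq_iteratedDeriv hu hcd.contDiffAt left_mem_uIcc,
        iteratedDeriv_pow_smul_cexp, Finset.sum_range_succ, Finset.sum_eq_zero]
      · have : (N.factorial : ℂ) ≠ 0 := by exact_mod_cast N.factorial_ne_zero
        simp [Nat.descFactorial_self]
        field_simp
      · intro i hi
        have : N - i ≠ 0 := by have := Finset.mem_range.1 hi; omega
        simp [this]
    · intro j hj
      rw [iteratedDerivWithin_eq_iteratedDeriv hu hcd.contDiffAt left_mem_uIcc,
        iteratedDeriv_pow_smul_cexp, Finset.sum_eq_zero, smul_zero]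
      intro i hi
      have : N - i ≠ 0 := by
        have := Finset.mem_range.1 hi; have := Finset.mem_range.1 hj; omega
      simp [this]
  rw [hpoly, sub_eq_iff_eq_add'] at hT
  have hv' : h v = ((v ^ N : ℝ) : ℂ) * cexp (v * w) := by simp [hh]
  rw [← hv', hT]
  congr 1
  refine intervalIntegral.integral_congr fun τ hτ => ?_
  rw [iteratedDerivWithin_eq_iteratedDeriv hu hcd.contDiffAt hτ, real_smul]
  push_cast
  ring

theorem rieszMean_zero_mul (lam : Frequency) (p : ℝ) (b : ℕ → ℂ) {x : ℝ} (hx : 0 < x) :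
    (x ^ p : ℝ) * rieszMean lam p b x 0 = perronSum lam p b x := by
  rw [rieszMean, perronSum, Finset.mul_sum]
  refine Finset.sum_congr rfl fun n hn => ?_
  have h := one_sub_div_mem hx hn
  have : x - lam.seq n = x * (1 - lam.seq n / x) := by field_simp
  rw [this, Real.mul_rpow hx.le h.1.le]
  simp
  ring

/-- A summation by parts: the Taylor identity at `v = x - λ_n`, summed over `n`, expresses the mean
at `w` through the Perron sums at the origin. -/
theorem pow_mul_cexp_mul_rieszMean {lam : Frequency} {N : ℕ} (hN : 0 < N) (b : ℕ → ℂ) {x : ℝ}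
    (hx : 0 < x) (w : ℂ) :
    ((x ^ N : ℝ) : ℂ) * cexp (x * w) * rieszMean lam N b x w = perronSum lam N b x +
      ∫ τ in (0 : ℝ)..x, perronSum lam N b (x - τ) * ((N.factorial : ℂ)⁻¹ *
        iteratedDeriv (N + 1) ((fun τ : ℝ => τ ^ N) • fun τ : ℝ => cexp (τ * w)) τ) := by
  have hNr : (0 : ℝ) < N := by exact_mod_cast hN
  set ψ : ℝ → ℂ := fun τ => (N.factorial : ℂ)⁻¹ *
    iteratedDeriv (N + 1) ((fun τ : ℝ => τ ^ N) • fun τ : ℝ => cexp (τ * w)) τ with hψ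
  have hψc : Continuous ψ := by
    refine continuous_const.mul (ContDiff.continuous_iteratedDeriv (n := (N + 1 : ℕ)) _ ?_ le_rfl)
    exact (contDiff_id.pow N).smul (contDiff_cexp_ofReal_mul w)
  have hmaxc : ∀ μ : ℝ, Continuous fun τ : ℝ => ((max (x - τ - μ) 0 ^ (N : ℝ) : ℝ) : ℂ) :=
    fun μ => continuous_ofReal.comp (Continuous.rpow_const (by fun_prop) fun _ => Or.inr hNr.le)
  have hterm : ∀ n ∈ lam.below x,
      ((x ^ N : ℝ) : ℂ) * cexp (x * w) * (b n * cexp (-(lam.seq n : ℂ) * w) *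
        (((1 - lam.seq n / x) ^ (N : ℝ) : ℝ) : ℂ)) =
      b n * (((x - lam.seq n) ^ (N : ℝ) : ℝ) : ℂ) + ∫ τ in (0 : ℝ)..x,
        b n * ((max (x - τ - lam.seq n) 0 ^ (N : ℝ) : ℝ) : ℂ) * ψ τ := by
    intro n hn
    have hlt := mem_below.1 hn
    have hv : 0 < x - lam.seq n := by linarith
    have hvx : x - lam.seq n ≤ x := by linarith [lam.nonneg n]
    have hint : ∫ τ in (0 : ℝ)..x, b n * ((max (x - τ - lam.seq n) 0 ^ (N : ℝ) : ℝ) : ℂ) * ψ τ =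
        b n * ∫ τ in (0 : ℝ)..(x - lam.seq n),
          (((x - lam.seq n - τ) ^ N : ℝ) : ℂ) * ψ τ := by
      have hii : ∀ u v : ℝ, IntervalIntegrable (fun τ : ℝ =>
          ((max (x - τ - lam.seq n) 0 ^ (N : ℝ) : ℝ) : ℂ) * ψ τ) volume u v := fun u v =>
        ((hmaxc _).mul hψc).intervalIntegrable u v
      simp_rw [mul_assoc]
      rw [intervalIntegral.integral_const_mul, ← intervalIntegral.integral_add_adjacent_intervals
        (hii 0 (x - lam.seq n)) (hii (x - lam.seq n) x)]
      have hz : ∫ τ in (x - lam.seq n)..x,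
          ((max (x - τ - lam.seq n) 0 ^ (N : ℝ) : ℝ) : ℂ) * ψ τ = 0 := by
        rw [intervalIntegral.integral_congr (g := fun _ => 0)]
        · simp
        · intro τ hτ
          rw [uIcc_of_le hvx] at hτ
          have : x - τ - lam.seq n ≤ 0 := by linarith [hτ.1]
          simp only
          rw [max_eq_right this, Real.zero_rpow hNr.ne']
          simp
      rw [hz, add_zero]
      congr 1
      refine intervalIntegral.integral_congr fun τ hτ => ?_
      rw [uIcc_of_le hv.le] at hτ
      have : 0 ≤ x - τ - lam.seq n := by linarith [hτ.2]
      rw [max_eq_left this, Real.rpow_natCast, sub_right_comm]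
    rw [hint, ← mul_add, Real.rpow_natCast, Real.rpow_natCast,
      ← pow_mul_cexp_eq_add_integral N w hv]
    have e1 : x - lam.seq n = x * (1 - lam.seq n / x) := by field_simp
    have e2 : cexp (((x - lam.seq n : ℝ) : ℂ) * w) =
        cexp (x * w) * cexp (-(lam.seq n : ℂ) * w) := by
      rw [← Complex.exp_add]; congr 1; push_cast; ring
    rw [e2, e1, mul_pow]
    push_cast
    ring
  rw [rieszMean, Finset.mul_sum, Finset.sum_congr rfl hterm, Finset.sum_add_distrib,
    ← intervalIntegral.integral_finsetSum]
  · congr 1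
    refine intervalIntegral.integral_congr fun τ hτ => ?_
    rw [uIcc_of_le hx.le] at hτ
    rw [perronSum_eq hNr b (below_mono lam (by linarith [hτ.1] : x - τ ≤ x)), Finset.sum_mul]
  · intro n _
    exact ((continuous_const.mul (hmaxc _)).mul hψc).intervalIntegrable _ _

/-- Bounded means at zero say that the Perron sums are `O(y^N)`. Inserted into the preceding
identity, the growth `e^τ` coming from `Re w = 1` is what the division by `x^N e^x` compensates. -/
theorem exists_norm_rieszMean_le_pow {lam : Frequency} {N : ℕ} (hN : 0 < N) {b : ℕ → ℂ} {C : ℝ}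
    (hC0 : 0 ≤ C) (hC : ∀ x, 0 < x → ‖rieszMean lam N b x 0‖ ≤ C) :
    ∃ D, ∀ x, 1 ≤ x → ∀ w : ℂ, w.re = 1 → ‖rieszMean lam N b x w‖ ≤ D * (1 + ‖w‖) ^ (N + 1) := by
  have hNr : (0 : ℝ) < N := by exact_mod_cast hN
  obtain ⟨E, hE0, hE⟩ := norm_iteratedDeriv_pow_smul_cexp_le N
  have hfac : (0 : ℝ) < N.factorial := by exact_mod_cast N.factorial_pos
  have hsum : ∀ y : ℝ, 0 ≤ y → ‖perronSum lam N b y‖ ≤ C * y ^ N := by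
    intro y hy
    rcases hy.eq_or_lt with rfl | hy
    · have : perronSum lam N b 0 = 0 := Finset.sum_eq_zero fun n hn =>
        absurd (mem_below.1 hn) (not_lt.2 (lam.nonneg n))
      rw [this, norm_zero]
      positivity
    · rw [← rieszMean_zero_mul lam _ b hy, norm_mul, norm_real,
        Real.norm_of_nonneg (by positivity), Real.rpow_natCast, mul_comm]
      gcongr
      exact hC y hy
  refine ⟨C + 2 * (C * E * 2 ^ N * 2 ^ N), fun x hx w hw => ?_⟩
  have hx0 : 0 < x := by linarith
  set W := (1 + ‖w‖) ^ (N + 1) with hW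
  have hW1 : 1 ≤ W := one_le_pow₀ (by linarith [norm_nonneg w])
  set Q := C * E * W * (2 ^ N * x ^ N) * 2 ^ N with hQ
  have hQ0 : 0 ≤ Q := by positivity
  have hpt : ∀ τ ∈ Ioc 0 x, ‖perronSum lam N b (x - τ) * ((N.factorial : ℂ)⁻¹ *
      iteratedDeriv (N + 1) ((fun τ : ℝ => τ ^ N) • fun τ : ℝ => cexp (τ * w)) τ)‖ ≤
      Q * Real.exp (x / 2) * Real.exp (τ / 2) := by
    intro τ hτ
    have hτ0 : 0 ≤ τ := hτ.1.le
    have hy : 0 ≤ x - τ := by linarith [hτ.2]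
    rw [norm_mul, norm_mul, norm_inv, norm_natCast]
    have h1 := hE w τ hτ0
    rw [hw, mul_one] at h1
    have h2 : (1 + τ) ^ N ≤ 2 ^ N * x ^ N := by
      rw [← mul_pow]
      exact pow_le_pow_left₀ (by linarith) (by linarith [hτ.2]) _
    -- Half an exponential absorbs this power, so that the integral over `τ` costs only `2 e^x` and
    -- no further power of `x`.
    have h3 : (x - τ) ^ N ≤ N.factorial * (2 ^ N * Real.exp ((x - τ) / 2)) := by
      have := Real.pow_div_factorial_le_exp ((x - τ) / 2) (by linarith) N
      rw [div_le_iff₀ hfac, div_pow, div_le_iff₀ (by positivity)] at this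
      linarith
    have h4 : Real.exp ((x - τ) / 2) * Real.exp τ = Real.exp (x / 2) * Real.exp (τ / 2) := by
      rw [← Real.exp_add, ← Real.exp_add]; congr 1; ring
    calc _ ≤ (C * (N.factorial * (2 ^ N * Real.exp ((x - τ) / 2)))) *
          ((N.factorial : ℝ)⁻¹ * (E * W * (2 ^ N * x ^ N) * Real.exp τ)) := by
          gcongr
          · exact (hsum _ hy).trans (by gcongr)
          · exact h1.trans (by gcongr)
      _ = Q * (Real.exp ((x - τ) / 2) * Real.exp τ) := by
          rw [hQ]; field_simp
      _ = _ := by rw [h4]; ring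
  have hexp : ∫ τ in (0 : ℝ)..x, Q * Real.exp (x / 2) * Real.exp (τ / 2) ≤
      Q * (2 * Real.exp x) := by
    rw [intervalIntegral.integral_const_mul, intervalIntegral.integral_comp_div
      (fun t => Real.exp t) two_ne_zero, integral_exp]
    have : Real.exp x = Real.exp (x / 2) * Real.exp (x / 2) := by
      rw [← Real.exp_add]; congr 1; ring
    rw [this, smul_eq_mul, zero_div, Real.exp_zero, mul_assoc]
    have : 0 < Real.exp (x / 2) := Real.exp_pos _
    refine mul_le_mul_of_nonneg_left ?_ hQ0
    nlinarith
  have hI := (intervalIntegral.norm_integral_le_of_norm_le hx0.le (ae_of_all _ hpt)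
    (Continuous.intervalIntegrable (by fun_prop) _ _)).trans hexp
  have hid := congrArg norm (pow_mul_cexp_mul_rieszMean hN b hx0 w (lam := lam))
  have hre : ((x : ℂ) * w).re = x := by simp [hw]
  rw [norm_mul, norm_mul, norm_real, Real.norm_of_nonneg (by positivity), Complex.norm_exp,
    hre] at hid
  have hpos : 0 < x ^ N * Real.exp x := by positivity
  refine le_of_mul_le_mul_left (hid.trans_le ?_) hpos
  refine (norm_add_le _ _).trans ((add_le_add (hsum x hx0.le) hI).trans ?_)
  have he : 1 ≤ Real.exp x := Real.one_le_exp hx0.le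
  calc C * x ^ N + Q * (2 * Real.exp x)
      ≤ C * x ^ N * (Real.exp x * W) + Q * (2 * Real.exp x) := by
        refine add_le_add_left (le_mul_of_one_le_right (by positivity) ?_) _
        exact one_le_mul_of_one_le_of_one_le he hW1
    _ = _ := by rw [hQ]; ring

/-! ### The Perron formula and uniqueness of the germ. -/

theorem perronIntegral_rieszMean (lam : Frequency) (m : ℝ) (a : ℕ → ℂ) {p c : ℝ} (hp : 0 < p)
    (hc : 0 < c) (x y : ℝ) :
    perronIntegral (rieszMean lam m a x) p c y = 2 * Real.pi / Real.Gamma (p + 1) *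
      ∑ n ∈ lam.below x, a n * (((1 - lam.seq n / x) ^ m : ℝ) : ℂ) *
        ((max (y - lam.seq n) 0 ^ p : ℝ) : ℂ) := by
  have hterm : ∀ t : ℝ, rieszMean lam m a x (vline c t) *
      (cexp (y * vline c t) * vline c t ^ ((-(1 + p) : ℝ) : ℂ)) =
      ∑ n ∈ lam.below x, a n * (((1 - lam.seq n / x) ^ m : ℝ) : ℂ) *
        (cexp ((y - lam.seq n : ℝ) * vline c t) * vline c t ^ ((-(1 + p) : ℝ) : ℂ)) := by
    intro t
    rw [rieszMean, Finset.sum_mul]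
    refine Finset.sum_congr rfl fun n _ => ?_
    have : cexp ((y - lam.seq n : ℝ) * vline c t) =
        cexp (-(lam.seq n : ℂ) * vline c t) * cexp (y * vline c t) := by
      rw [← Complex.exp_add]; congr 1; push_cast; ring
    rw [this]
    ring
  have hint : ∀ q : ℝ, Integrable fun t : ℝ =>
      cexp (q * vline c t) * vline c t ^ ((-(1 + p) : ℝ) : ℂ) := fun q => by
    simpa using integrable_perron_integrand (g := fun _ => 1) (K := 1) le_rfl hp hc q
      aestronglyMeasurable_const (fun t => by simp)
  rw [perronIntegral]
  simp_rw [hterm]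
  rw [integral_finsetSum _ fun n _ => (hint _).const_mul _, Finset.mul_sum]
  refine Finset.sum_congr rfl fun n _ => ?_
  rw [integral_const_mul, integral_cexp_mul_vline_cpow hp hc]
  ring

/-- The Perron formula of large order on vertical lines far to the right. -/
theorem IsRieszGerm.perron_formula_of_large {lam : Frequency} {a : ℕ → ℂ} {g : ℂ → ℂ}
    (h : IsRieszGerm lam a g) : ∃ L c₀ : ℝ, ∀ p, L < p → ∀ c, c₀ < c → ∀ y,
      perronIntegral g p c y = 2 * Real.pi / Real.Gamma (p + 1) * perronSum lam p a y := by
  obtain ⟨m, hm, σ, hlim⟩ := h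
  -- An integer order is needed for the Taylor identity; the extra one makes `q = N - m - 1`
  -- non-negative.
  set N : ℕ := ⌈m⌉₊ + 1 with hN
  have hmN : m + (N - m - 1) + 1 = N := by ring
  have hNm : 0 ≤ N - m - 1 := by
    have := Nat.le_ceil m
    rw [hN]; push_cast; linarith
  have hlimN : ∀ s ∈ halfPlane 0, s ∈ halfPlane σ →
      Tendsto (fun x : ℝ => rieszMean lam N a x s) atTop (𝓝 (g s)) := by
    intro s h1 h2
    have := tendsto_rieszMean_of_order_le hm hNm (hlim s h1 h2)
    rwa [hmN] at this
  -- Order above `N + 1` beats the growth exponent of the means; the extra unit of abscissa leaves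
  -- room for the base point `c - 1` inside the region of summability.
  refine ⟨N + 1, max σ 0 + 1, fun p hp c hc y => ?_⟩
  have hσc : σ < c - 1 := by linarith [le_max_left σ 0]
  have h0c : 0 < c - 1 := by linarith [le_max_right σ 0]
  have hc0 : 0 < c := by linarith
  have hN0 : (0 : ℝ) ≤ N := N.cast_nonneg
  have hp0 : 0 < p := by linarith
  have hbase := hlimN ((c - 1 : ℝ) : ℂ) (by simpa [halfPlane] using h0c)
    (by simpa only [mem_halfPlane, ofReal_re] using hσc)
  obtain ⟨C, hC0, hC⟩ := exists_norm_rieszMean_le N.cast_nonneg hbase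
  obtain ⟨D, hD⟩ := exists_norm_rieszMean_le_pow (lam := lam) (N := N) (by omega)
    (b := twist lam a ((c - 1 : ℝ) : ℂ)) hC0 fun x hx => by
      rw [← rieszMean_add, add_zero]; exact hC x hx
  have hv : ∀ t, vline c t = ((c - 1 : ℝ) : ℂ) + vline 1 t := fun t => by
    simp [vline]; ring
  have hbound : ∀ x, 1 ≤ x → ∀ t, ‖rieszMean lam N a x (vline c t)‖ ≤
      |D| * (1 + ‖vline c t‖) ^ ((N : ℝ) + 1) := by
    intro x hx t
    rw [hv t, rieszMean_add]
    refine (hD x hx _ (vline_re 1 t)).trans ?_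
    rw [← hv t]
    have h1 : ‖vline 1 t‖ ≤ ‖vline c t‖ := norm_vline_mono zero_le_one (by linarith) t
    have h2 : ((N : ℝ) + 1) = ((N + 1 : ℕ) : ℝ) := by push_cast; ring
    rw [h2, Real.rpow_natCast]
    gcongr
    exact le_abs_self D
  have hcont : ∀ x, Continuous fun t => rieszMean lam N a x (vline c t) := fun x => by
    unfold rieszMean; fun_prop
  have hL : Tendsto (fun x => perronIntegral (rieszMean lam N a x) p c y) atTop
      (𝓝 (perronIntegral g p c y)) := by
    refine tendsto_integral_filter_of_dominated_convergence
      (fun t => |D| * Real.exp (y * c) *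
        ((1 + ‖vline c t‖) ^ ((N : ℝ) + 1) * ‖vline c t‖ ^ (-(1 + p)))) ?_ ?_ ?_ ?_
    · exact Eventually.of_forall fun x =>
        aestronglyMeasurable_perron_integrand hc0 y p (hcont x).aestronglyMeasurable
    · filter_upwards [eventually_ge_atTop 1] with x hx
      exact ae_of_all _ fun t => norm_perron_integrand_le y (hbound x hx t)
    · exact (integrable_weight_vline (by positivity) hp hc0).const_mul _
    · refine ae_of_all _ fun t => (hlimN _ ?_ ?_).mul_const _
      · simpa [halfPlane] using hc0
      · simp only [mem_halfPlane, vline_re]; linarith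
  -- The same limit computed termwise: for `x ≥ y` only indices with `λ_n < y` contribute, and their
  -- Riesz factors tend to one.
  have hR : Tendsto (fun x => perronIntegral (rieszMean lam N a x) p c y) atTop
      (𝓝 (2 * Real.pi / Real.Gamma (p + 1) * perronSum lam p a y)) := by
    have hfin : Tendsto (fun x : ℝ => ∑ n ∈ lam.below y,
        a n * (((1 - lam.seq n / x) ^ (N : ℝ) : ℝ) : ℂ) *
          (((y - lam.seq n) ^ p : ℝ) : ℂ)) atTop (𝓝 (perronSum lam p a y)) := by
      refine tendsto_finsetSum _ fun n _ => Tendsto.mul_const _ ?_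
      have h1 : Tendsto (fun x : ℝ => (1 - lam.seq n / x) ^ (N : ℝ)) atTop (𝓝 1) := by
        have := (tendsto_const_nhds (x := (1 : ℝ))).sub
          ((tendsto_const_nhds (x := lam.seq n)).div_atTop tendsto_id)
        simpa using this.rpow_const (p := (N : ℝ)) (Or.inr hN0)
      simpa using ((continuous_ofReal.tendsto 1).comp h1).const_mul (a n)
    refine (hfin.const_mul _).congr' ?_
    filter_upwards [eventually_ge_atTop y] with x hx
    rw [perronIntegral_rieszMean lam N a hp0 hc0]
    congr 1
    exact perronSum_eq hp0 (fun n => a n * (((1 - lam.seq n / x) ^ (N : ℝ) : ℝ) : ℂ))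
      (below_mono lam hx)
  exact tendsto_nhds_unique hL hR

/-- The system is triangular: at `y = λ_{n+1}` only the coefficients up to `n` enter, the last one
with a nonzero factor. -/
theorem eq_of_perronSum_eq {lam : Frequency} {p : ℝ} {a b : ℕ → ℂ}
    (h : ∀ y, perronSum lam p a y = perronSum lam p b y) : a = b := by
  ext n
  induction n using Nat.strong_induction_on with
  | _ n ih =>
    have hb : lam.below (lam.seq (n + 1)) = Finset.range (n + 1) := by
      ext j; rw [mem_below, lam.strictMono.lt_iff_lt, Finset.mem_range]
    have hn := h (lam.seq (n + 1))
    rw [perronSum, perronSum, hb, Finset.sum_range_succ, Finset.sum_range_succ,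
      Finset.sum_congr rfl fun j hj => by rw [ih j (Finset.mem_range.1 hj)]] at hn
    have hpos : 0 < lam.seq (n + 1) - lam.seq n := sub_pos.2 (lam.strictMono n.lt_succ_self)
    have hne : (((lam.seq (n + 1) - lam.seq n) ^ p : ℝ) : ℂ) ≠ 0 := by
      exact_mod_cast (Real.rpow_pos_of_pos hpos p).ne'
    exact mul_right_cancel₀ hne (add_left_cancel hn)

/-- A function has at most one Riesz germ. -/
theorem IsRieszGerm.unique {lam : Frequency} {a b : ℕ → ℂ} {g : ℂ → ℂ}
    (ha : IsRieszGerm lam a g) (hb : IsRieszGerm lam b g) : a = b := by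
  obtain ⟨L₁, c₁, h₁⟩ := ha.perron_formula_of_large
  obtain ⟨L₂, c₂, h₂⟩ := hb.perron_formula_of_large
  set p := max (max L₁ L₂) 0 + 1
  have hp0 : 0 < p := by linarith [le_max_right (max L₁ L₂) 0]
  have hp₁ : L₁ < p := by linarith [le_max_left (max L₁ L₂) 0, le_max_left L₁ L₂]
  have hp₂ : L₂ < p := by linarith [le_max_left (max L₁ L₂) 0, le_max_right L₁ L₂]
  set c := max c₁ c₂ + 1
  have hc₁ : c₁ < c := by linarith [le_max_left c₁ c₂]
  have hc₂ : c₂ < c := by linarith [le_max_right c₁ c₂]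
  refine eq_of_perronSum_eq (lam := lam) (p := p) fun y => ?_
  have hΓ : (2 * Real.pi / Real.Gamma (p + 1) : ℂ) ≠ 0 := by
    have h := (Real.Gamma_pos_of_pos (by linarith : 0 < p + 1)).ne'
    have hpi := Real.pi_ne_zero
    refine div_ne_zero (mul_ne_zero two_ne_zero ?_) ?_ <;> exact_mod_cast ‹_›
  exact mul_left_cancel₀ hΓ ((h₁ p hp₁ c hc₁ y).symm.trans (h₂ p hp₂ c hc₂ y))

/-- The Perron formula for a function of polynomial growth with a Riesz germ. -/
theorem IsRieszGerm.perron_formula {lam : Frequency} {a : ℕ → ℂ} {g : ℂ → ℂ} {K l k c : ℝ}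
    (h : IsRieszGerm lam a g) (hl : 0 ≤ l) (hlk : l < k)
    (hg : DifferentiableOn ℂ g (halfPlane 0))
    (hgb : ∀ w ∈ halfPlane 0, ‖g w‖ ≤ K * (1 + ‖w‖) ^ l) (hc : 0 < c) (x : ℝ) :
    perronIntegral g k c x = 2 * Real.pi / Real.Gamma (k + 1) * perronSum lam k a x := by
  obtain ⟨L, c₀, hL⟩ := h.perron_formula_of_large
  set c' := max c₀ c + 1
  have hcc : c ≤ c' := by linarith [le_max_right c₀ c]
  have hc' : 0 < c' := hc.trans_le hcc
  rw [perronIntegral_eq_of_le hl hlk hg hgb hc hcc]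
  -- Induction on the number `j` of unit steps needed to lift `k` above `L`.
  have hdesc : ∀ (j : ℕ) (k : ℝ), l < k → L < k + j → ∀ x, perronIntegral g k c' x =
      2 * Real.pi / Real.Gamma (k + 1) * perronSum lam k a x := by
    intro j
    induction j with
    | zero =>
      intro k _ hk
      exact hL k (by simpa using hk) c' (by linarith [le_max_left c₀ c])
    | succ j ih =>
      intro k hlk hk
      refine perron_formula_of_succ hl hlk hc' (continuous_comp_vline hg hc').aestronglyMeasurable
        (fun t => hgb _ (by simpa [halfPlane] using hc')) (ih (k + 1) (by linarith) ?_)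
      push_cast at hk
      linarith
  obtain ⟨j, hj⟩ := exists_nat_gt (L - k)
  exact hdesc j k hlk (by linarith) x

/-! ### Translates and increments of functions of polynomial growth. -/

theorem IsRieszGerm.translate {lam : Frequency} {a : ℕ → ℂ} {f : ℂ → ℂ}
    (h : IsRieszGerm lam a f) {z : ℂ} (hz : 0 ≤ z.re) :
    IsRieszGerm lam (twist lam a z) fun w => f (z + w) := by
  obtain ⟨m, hm, σ, hlim⟩ := h
  refine ⟨m, hm, σ, fun s hs hσ => ?_⟩
  have hs : 0 < s.re := hs
  have hσ : σ < s.re := hσ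
  simp_rw [← rieszMean_add]
  refine hlim _ ?_ ?_ <;> simp only [mem_halfPlane, add_re] <;> linarith

theorem one_add_norm_add_rpow_le {l : ℝ} (hl : 0 ≤ l) (z h : ℂ) :
    (1 + ‖z + h‖) ^ l ≤ (1 + ‖z‖) ^ l * (1 + ‖h‖) ^ l := by
  rw [← Real.mul_rpow (by positivity) (by positivity)]
  refine Real.rpow_le_rpow (by positivity) ?_ hl
  nlinarith [norm_add_le z h, mul_nonneg (norm_nonneg z) (norm_nonneg h)]

/-- Cauchy's estimate on the disc of radius `u / 2`, which stays inside the half-plane. -/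
theorem norm_deriv_le_of_growth {f : ℂ → ℂ} {K l u : ℝ} (hl : 0 ≤ l) (hu : 0 < u)
    (hf : DifferentiableOn ℂ f (halfPlane 0)) (hK : 0 ≤ K)
    (hfb : ∀ w ∈ halfPlane 0, ‖f w‖ ≤ K * (1 + ‖w‖) ^ l) {z : ℂ} (hz : u ≤ z.re) :
    ‖deriv f z‖ ≤ K * (2 / u * (1 + u / 2) ^ l) * (1 + ‖z‖) ^ l := by
  have hsub : Metric.closedBall z (u / 2) ⊆ halfPlane 0 := by
    intro w hw
    rw [mem_halfPlane]
    have h1 : ‖w - z‖ ≤ u / 2 := by simpa [dist_eq_norm] using hw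
    have h2 := (abs_le.1 ((Complex.abs_re_le_norm (w - z)).trans h1)).1
    rw [sub_re] at h2
    linarith
  have h := Complex.norm_deriv_le_of_forall_mem_sphere_norm_le (c := z) (R := u / 2)
    (C := K * ((1 + ‖z‖) ^ l * (1 + u / 2) ^ l)) (by positivity) (hf.diffContOnCl_ball hsub) ?_
  · refine h.trans_eq ?_
    field_simp
  · intro w hw
    have h1 : ‖w - z‖ = u / 2 := by simpa [dist_eq_norm] using hw
    refine (hfb w (hsub (Metric.sphere_subset_closedBall hw))).trans ?_
    gcongr
    have := one_add_norm_add_rpow_le hl z (w - z)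
    rwa [add_sub_cancel, h1] at this

/-- The triangle inequality serves for large `h`, the mean value inequality for small `h`; the `min`
records the better of the two. -/
theorem norm_sub_le_of_growth {f : ℂ → ℂ} {K l u : ℝ} (hl : 0 ≤ l) (hu : 0 < u)
    (hf : DifferentiableOn ℂ f (halfPlane 0)) (hK : 0 ≤ K)
    (hfb : ∀ w ∈ halfPlane 0, ‖f w‖ ≤ K * (1 + ‖w‖) ^ l) {z h : ℂ} (hz : u ≤ z.re)
    (hh : 0 ≤ h.re) :
    ‖f (z + h) - f z‖ ≤ K * (2 + 2 / u * (1 + u / 2) ^ l) * (1 + ‖z‖) ^ l *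
      (min 1 ‖h‖ * (1 + ‖h‖) ^ l) := by
  set B := 2 / u * (1 + u / 2) ^ l
  have hB : 0 ≤ B := by positivity
  set W := (1 + ‖z‖) ^ l * (1 + ‖h‖) ^ l with hW
  have hW0 : 0 ≤ W := by positivity
  have hz0 : 0 < z.re := hu.trans_le hz
  have h1 : ‖f (z + h) - f z‖ ≤ K * 2 * W := by
    refine (norm_sub_le _ _).trans ?_
    have e1 := (hfb (z + h) (by rw [mem_halfPlane, add_re]; linarith)).trans
      (mul_le_mul_of_nonneg_left (one_add_norm_add_rpow_le hl z h) hK)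
    have e2 : ‖f z‖ ≤ K * W := by
      refine (hfb z hz0).trans (mul_le_mul_of_nonneg_left ?_ hK)
      exact le_mul_of_one_le_right (by positivity)
        (Real.one_le_rpow (by linarith [norm_nonneg h]) hl)
    linarith
  have h2 : ‖f (z + h) - f z‖ ≤ K * B * W * ‖h‖ := by
    -- Intersecting with a ball keeps `|w| ≤ |z| + |h|`, so the derivative bound is uniform along
    -- the segment.
    have hconv : Convex ℝ ({w : ℂ | u ≤ w.re} ∩ Metric.closedBall 0 (‖z‖ + ‖h‖)) :=
      (convex_halfSpace_re_ge u).inter (convex_closedBall _ _)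
    have := hconv.norm_image_sub_le_of_norm_deriv_le (f := f) (C := K * B * W) (x := z)
      (y := z + h) (fun w hw => ?_) (fun w hw => ?_) ?_ ?_
    · simpa using this
    · exact hf.differentiableAt ((isOpen_halfPlane 0).mem_nhds (hu.trans_le hw.1))
    · refine (norm_deriv_le_of_growth hl hu hf hK hfb hw.1).trans ?_
      have hw2 : ‖w‖ ≤ ‖z‖ + ‖h‖ := by simpa using hw.2
      rw [hW, ← Real.mul_rpow (by positivity) (by positivity)]
      gcongr
      nlinarith [mul_nonneg (norm_nonneg z) (norm_nonneg h)]
    · exact ⟨hz, by simp⟩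
    · refine ⟨?_, by simpa using norm_add_le z h⟩
      change u ≤ (z + h).re
      rw [add_re]; linarith
  have hmain : ‖f (z + h) - f z‖ ≤ K * (2 + B) * W * min 1 ‖h‖ := by
    rcases le_total 1 ‖h‖ with h' | h'
    · rw [min_eq_left h', mul_one]
      refine h1.trans ?_
      gcongr
      linarith
    · rw [min_eq_right h']
      refine h2.trans ?_
      gcongr
      linarith
  refine hmain.trans_eq ?_
  rw [hW]; ring

/-! ### The integral representation and the rate of convergence. -/

/-- The Riesz mean of `f` at `z` as a weighted average of the values of `f` on a vertical line
to the right of `z`. -/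
theorem IsRieszGerm.rieszMean_eq_integral {lam : Frequency} {a : ℕ → ℂ} {f : ℂ → ℂ} {K l k : ℝ}
    (h : IsRieszGerm lam a f) (hl : 0 ≤ l) (hlk : l < k)
    (hf : DifferentiableOn ℂ f (halfPlane 0)) (hK : 0 ≤ K)
    (hfb : ∀ w ∈ halfPlane 0, ‖f w‖ ≤ K * (1 + ‖w‖) ^ l) {x : ℝ} (hx : 0 < x) {z : ℂ}
    (hz : 0 < z.re) :
    rieszMean lam k a x z = Real.Gamma (k + 1) / (2 * Real.pi) * ∫ t : ℝ,
      f (z + (x⁻¹ : ℝ) * vline 1 t) *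
        (cexp (vline 1 t) * vline 1 t ^ ((-(1 + k) : ℝ) : ℂ)) := by
  have hΓ : (Real.Gamma (k + 1) : ℂ) ≠ 0 := by
    exact_mod_cast (Real.Gamma_pos_of_pos (by linarith)).ne'
  have hpi : (Real.pi : ℂ) ≠ 0 := by exact_mod_cast Real.pi_ne_zero
  have hxk : ((x ^ k : ℝ) : ℂ) ≠ 0 := by exact_mod_cast (Real.rpow_pos_of_pos hx k).ne'
  have hadd : ∀ w ∈ halfPlane 0, z + w ∈ halfPlane 0 := fun w hw => by
    have : 0 < w.re := hw
    rw [mem_halfPlane, add_re]; linarith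
  -- On the abscissa `1/x` the factor `e^{xw}` has constant modulus `e`, and scaling by `x` carries
  -- the line to `[Re = 1]`.
  have hP := (h.translate hz.le).perron_formula hl hlk (K := K * (1 + ‖z‖) ^ l)
    (hf.comp (by fun_prop) hadd) (fun w hw => ?_) (inv_pos.2 hx) x
  · rw [← rieszMean_zero_mul lam k _ hx, ← rieszMean_add, add_zero] at hP
    have hsub := MeasureTheory.Measure.integral_comp_mul_left (fun t : ℝ =>
      f (z + vline x⁻¹ t) * (cexp (x * vline x⁻¹ t) * vline x⁻¹ t ^ ((-(1 + k) : ℝ) : ℂ))) x⁻¹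
    have hpt : ∀ t : ℝ, f (z + vline x⁻¹ (x⁻¹ * t)) * (cexp (x * vline x⁻¹ (x⁻¹ * t)) *
        vline x⁻¹ (x⁻¹ * t) ^ ((-(1 + k) : ℝ) : ℂ)) = ((x ^ k : ℝ) : ℂ) * x *
        (f (z + (x⁻¹ : ℝ) * vline 1 t) *
          (cexp (vline 1 t) * vline 1 t ^ ((-(1 + k) : ℝ) : ℂ))) := by
      intro t
      have hv : vline x⁻¹ (x⁻¹ * t) = (x⁻¹ : ℝ) * vline 1 t := by
        simp [vline]; ring
      have hxv : (x : ℂ) * ((x⁻¹ : ℝ) * vline 1 t) = vline 1 t := by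
        rw [← mul_assoc, ← ofReal_mul, mul_inv_cancel₀ hx.ne', ofReal_one, one_mul]
      have hpow : ((x⁻¹ : ℝ) * vline 1 t) ^ ((-(1 + k) : ℝ) : ℂ) =
          ((x ^ k : ℝ) : ℂ) * x * vline 1 t ^ ((-(1 + k) : ℝ) : ℂ) := by
        have : (x⁻¹) ^ (-(1 + k)) = x ^ k * x := by
          rw [Real.inv_rpow hx.le, Real.rpow_neg hx.le, inv_inv, add_comm,
            Real.rpow_add_one hx.ne']
        have hxi : 0 < x⁻¹ := inv_pos.2 hx
        have hv0 : vline 1 t ≠ 0 := norm_pos_iff.1 (norm_vline_pos one_pos t)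
        have hxi0 : ((x⁻¹ : ℝ) : ℂ) ≠ 0 := by exact_mod_cast hxi.ne'
        rw [← ofReal_mul, ← this, ofReal_cpow hxi.le, cpow_def_of_ne_zero (mul_ne_zero hxi0 hv0),
          cpow_def_of_ne_zero hxi0, cpow_def_of_ne_zero hv0, log_ofReal_mul hxi hv0, add_mul,
          Complex.exp_add, ofReal_log hxi.le]
      rw [hv, hxv, hpow]
      ring
    simp_rw [hpt] at hsub
    rw [integral_const_mul, inv_inv, abs_of_pos hx, real_smul] at hsub
    have hx0 : (x : ℂ) ≠ 0 := by exact_mod_cast hx.ne'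
    have hI : perronIntegral (fun w => f (z + w)) k x⁻¹ x = ((x ^ k : ℝ) : ℂ) * ∫ t : ℝ,
        f (z + (x⁻¹ : ℝ) * vline 1 t) *
          (cexp (vline 1 t) * vline 1 t ^ ((-(1 + k) : ℝ) : ℂ)) := by
      refine mul_left_cancel₀ hx0 (hsub.symm.trans ?_)
      ring
    rw [hI] at hP
    refine mul_left_cancel₀ hxk ?_
    rw [mul_left_comm, hP]
    field_simp
  · refine (hfb _ (hadd w hw)).trans ?_
    rw [mul_assoc]
    exact mul_le_mul_of_nonneg_left (one_add_norm_add_rpow_le hl z w) hK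

/-- Riesz means converge, in the weighted sense, uniformly on `[Re ≥ u]` and at a rate depending
only on the growth of the function. -/
theorem exists_rate_norm_sub_rieszMean_le {l k u : ℝ} (hl : 0 ≤ l) (hlk : l < k) (hu : 0 < u) :
    ∃ η : ℝ → ℝ, Tendsto η atTop (𝓝 0) ∧ (∀ x, 0 ≤ η x) ∧
      ∀ (lam : Frequency) (a : ℕ → ℂ) (f : ℂ → ℂ) (K : ℝ), 0 ≤ K → IsRieszGerm lam a f →
        DifferentiableOn ℂ f (halfPlane 0) →
        (∀ w ∈ halfPlane 0, ‖f w‖ ≤ K * (1 + ‖w‖) ^ l) → ∀ x, 1 ≤ x → ∀ z : ℂ, u ≤ z.re →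
          ‖f z - rieszMean lam k a x z‖ ≤ K * η x * (1 + ‖z‖) ^ l := by
  have hk : 0 < k := hl.trans_lt hlk
  have hΓ : 0 < Real.Gamma (k + 1) := Real.Gamma_pos_of_pos (by linarith)
  set ω : ℝ → ℝ := fun t => (1 + ‖vline 1 t‖) ^ l * ‖vline 1 t‖ ^ (-(1 + k)) with hω
  have hω0 : ∀ t, 0 ≤ ω t := fun t => by positivity
  have hωi : Integrable ω := integrable_weight_vline hl hlk one_pos
  set B := 2 + 2 / u * (1 + u / 2) ^ l
  have hB : 0 ≤ B := by positivity
  set J : ℝ → ℝ := fun x => ∫ t : ℝ, min 1 (x⁻¹ * ‖vline 1 t‖) * ω t with hJ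
  have hmin0 : ∀ {x : ℝ}, 0 < x → ∀ t, 0 ≤ min 1 (x⁻¹ * ‖vline 1 t‖) := fun hx t =>
    le_min zero_le_one (by positivity)
  have hmeas : ∀ x : ℝ, AEStronglyMeasurable fun t : ℝ => min 1 (x⁻¹ * ‖vline 1 t‖) * ω t :=
    fun x => AEStronglyMeasurable.mul (Continuous.aestronglyMeasurable (by fun_prop))
      hωi.aestronglyMeasurable
  have hle : ∀ {x : ℝ}, 0 < x → ∀ t, ‖min 1 (x⁻¹ * ‖vline 1 t‖) * ω t‖ ≤ ω t := fun hx t => by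
    rw [Real.norm_of_nonneg (mul_nonneg (hmin0 hx t) (hω0 t))]
    exact mul_le_of_le_one_left (hω0 t) (min_le_left _ _)
  have hJlim : Tendsto J atTop (𝓝 0) := by
    have := tendsto_integral_filter_of_dominated_convergence (μ := volume) (l := atTop)
      (F := fun x t : ℝ => min 1 (x⁻¹ * ‖vline 1 t‖) * ω t) (f := fun _ => 0) ω
      (Eventually.of_forall hmeas)
      (by filter_upwards [eventually_gt_atTop 0] with x hx using ae_of_all _ (hle hx)) hωi
      (ae_of_all _ fun t => ?_)
    · simpa using this
    · have h1 : Tendsto (fun x : ℝ => min 1 (x⁻¹ * ‖vline 1 t‖)) atTop (𝓝 0) := by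
        have := (tendsto_const_nhds (x := (1 : ℝ))).min
          (tendsto_inv_atTop_zero.mul_const ‖vline 1 t‖)
        simpa using this
      simpa using h1.mul_const (ω t)
  set A := Real.Gamma (k + 1) / (2 * Real.pi) * (B * Real.exp 1)
  have hA : 0 ≤ A := by positivity
  -- The absolute value makes the rate non-negative also for `x < 0`, where the integrand of `J` is
  -- negative.
  refine ⟨fun x => A * |J x|, by simpa using hJlim.abs.const_mul A, fun x => by positivity, ?_⟩
  intro lam a f K hK hgerm hf hfb x hx z hz
  have hx0 : 0 < x := by linarith
  have hxi : x⁻¹ ≤ 1 := inv_le_one_of_one_le₀ hx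
  have hz0 : 0 < z.re := hu.trans_le hz
  set E : ℝ → ℂ := fun t => cexp (vline 1 t) * vline 1 t ^ ((-(1 + k) : ℝ) : ℂ) with hE
  have hEn : ∀ t, ‖E t‖ = Real.exp 1 * ‖vline 1 t‖ ^ (-(1 + k)) := fun t => by
    rw [hE, norm_mul, Complex.norm_exp, vline_re, norm_cpow_vline]
  have hEc : Continuous E :=
    Continuous.mul (by fun_prop) (continuous_vline_cpow one_pos _)
  have hre : ∀ t, ((x⁻¹ : ℝ) * vline 1 t : ℂ).re = x⁻¹ := fun t => by
    rw [re_ofReal_mul, vline_re, mul_one]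
  have hnorm : ∀ t, ‖((x⁻¹ : ℝ) * vline 1 t : ℂ)‖ = x⁻¹ * ‖vline 1 t‖ := fun t => by
    rw [norm_mul, norm_real, Real.norm_of_nonneg (by positivity)]
  have hEi : Integrable E := by
    have := integrable_perron_integrand (g := fun _ => 1) (K := 1) le_rfl hk one_pos 1
      aestronglyMeasurable_const (fun t => by simp)
    simpa only [ofReal_one, one_mul] using this
  -- The Perron kernel at `y = 1` gives the normalised kernel total mass one.
  have hconst : f z = Real.Gamma (k + 1) / (2 * Real.pi) * ∫ t : ℝ, f z * E t := by
    have h1 := integral_cexp_mul_vline_cpow hk one_pos 1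
    simp only [ofReal_one, one_mul, max_eq_left zero_le_one, Real.one_rpow, mul_one] at h1
    rw [integral_const_mul, hE, h1]
    have hΓ' : (Real.Gamma (k + 1) : ℂ) ≠ 0 := by exact_mod_cast hΓ.ne'
    have hpi : (Real.pi : ℂ) ≠ 0 := by exact_mod_cast Real.pi_ne_zero
    field_simp
  have hdiff : ∀ t, ‖(f (z + (x⁻¹ : ℝ) * vline 1 t) - f z) * E t‖ ≤
      K * B * (1 + ‖z‖) ^ l * Real.exp 1 * (min 1 (x⁻¹ * ‖vline 1 t‖) * ω t) := by
    intro t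
    have h1 := norm_sub_le_of_growth hl hu hf hK hfb hz
      (h := (x⁻¹ : ℝ) * vline 1 t) (by rw [hre]; positivity)
    rw [hnorm] at h1
    rw [norm_mul, hEn]
    have h2 : (1 + x⁻¹ * ‖vline 1 t‖) ^ l ≤ (1 + ‖vline 1 t‖) ^ l := by
      gcongr
      exact mul_le_of_le_one_left (norm_nonneg _) hxi
    have h3 := hmin0 hx0 t
    calc _ ≤ K * B * (1 + ‖z‖) ^ l * (min 1 (x⁻¹ * ‖vline 1 t‖) * (1 + ‖vline 1 t‖) ^ l) *
          (Real.exp 1 * ‖vline 1 t‖ ^ (-(1 + k))) := by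
          gcongr
          exact h1.trans (by gcongr)
      _ = _ := by rw [hω]; ring
  have hdi : Integrable fun t => min 1 (x⁻¹ * ‖vline 1 t‖) * ω t :=
    hωi.mono' (hmeas x) (ae_of_all _ (hle hx0))
  have hcont : Continuous fun t => f (z + (x⁻¹ : ℝ) * vline 1 t) := by
    refine hf.continuousOn.comp_continuous (by fun_prop) fun t => ?_
    rw [mem_halfPlane, add_re, hre]
    positivity
  have hDi : Integrable fun t => (f (z + (x⁻¹ : ℝ) * vline 1 t) - f z) * E t :=
    (hdi.const_mul _).mono' ((hcont.sub continuous_const).mul hEc).aestronglyMeasurable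
      (ae_of_all _ hdiff)
  have hFi : Integrable fun t => f (z + (x⁻¹ : ℝ) * vline 1 t) * E t := by
    refine (hDi.add (hEi.const_mul (f z))).congr (ae_of_all _ fun t => ?_)
    simp only [Pi.add_apply]
    ring
  have hrep : rieszMean lam k a x z - f z = Real.Gamma (k + 1) / (2 * Real.pi) *
      ∫ t : ℝ, (f (z + (x⁻¹ : ℝ) * vline 1 t) - f z) * E t := by
    simp_rw [sub_mul]
    rw [integral_sub hFi (hEi.const_mul _), mul_sub, ← hconst,
      hgerm.rieszMean_eq_integral hl hlk hf hK hfb hx0 hz0]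
  have hcoef : ‖(Real.Gamma (k + 1) / (2 * Real.pi) : ℂ)‖ =
      Real.Gamma (k + 1) / (2 * Real.pi) := by
    rw [show (Real.Gamma (k + 1) / (2 * Real.pi) : ℂ) =
      ((Real.Gamma (k + 1) / (2 * Real.pi) : ℝ) : ℂ) by push_cast; ring, norm_real,
      Real.norm_of_nonneg (by positivity)]
  rw [norm_sub_rev, hrep, norm_mul, hcoef]
  have hI := norm_integral_le_of_norm_le (hdi.const_mul _) (ae_of_all _ hdiff)
  rw [integral_const_mul] at hI
  calc _ ≤ Real.Gamma (k + 1) / (2 * Real.pi) *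
        (K * B * (1 + ‖z‖) ^ l * Real.exp 1 * |J x|) := by
        gcongr
        exact hI.trans (mul_le_mul_of_nonneg_left (le_abs_self _) (by positivity))
    _ = _ := by ring

/-! ### From pointwise estimates to the norm. -/

theorem growthNorm_le_of_forall {l K : ℝ} {f : ℂ → ℂ}
    (h : ∀ s ∈ halfPlane 0, ‖f s‖ ≤ K * (1 + ‖s‖) ^ l) :
    growthNorm l f ≤ ENNReal.ofReal K := by
  refine iSup₂_le fun s hs => ENNReal.ofReal_le_ofReal ?_
  rw [div_le_iff₀ (by positivity)]
  exact h s hs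

theorem norm_le_of_growthNorm_le {l : ℝ} {f : ℂ → ℂ} {B : ENNReal} (hB : B < ⊤)
    (h : growthNorm l f ≤ B) : ∀ s ∈ halfPlane 0, ‖f s‖ ≤ B.toReal * (1 + ‖s‖) ^ l := by
  intro s hs
  have h1 : ENNReal.ofReal (‖f s‖ / (1 + ‖s‖) ^ l) ≤ B :=
    (le_iSup₂ (f := fun s (_ : s ∈ halfPlane 0) =>
      ENNReal.ofReal (‖f s‖ / (1 + ‖s‖) ^ l)) s hs).trans h
  have h2 := (ENNReal.ofReal_le_iff_le_toReal hB.ne).1 h1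
  rwa [div_le_iff₀ (by positivity)] at h2

theorem isRieszGerm_bohrCoeff {lam : Frequency} {f : ℂ → ℂ} (h : ∃ a, IsRieszGerm lam a f) :
    IsRieszGerm lam (bohrCoeff lam f) f := by
  rw [bohrCoeff, dif_pos h]
  exact h.choose_spec

theorem add_mem_halfPlane {u : ℝ} (hu : 0 < u) {s : ℂ} (hs : s ∈ halfPlane 0) :
    (u : ℂ) + s ∈ halfPlane 0 := by
  have : 0 < s.re := hs
  rw [mem_halfPlane, add_re, ofReal_re]
  linarith

theorem translate_mem_H {lam : Frequency} {l : ℝ} (hl : 0 ≤ l) {f : ℂ → ℂ} (hf : f ∈ H lam l)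
    {u : ℝ} (hu : 0 < u) : translate u f ∈ H lam l := by
  obtain ⟨hd, ⟨a, ha⟩, hb⟩ := hf
  refine ⟨hd.comp (by fun_prop) fun s hs => add_mem_halfPlane hu hs,
    ⟨_, ha.translate (z := u) (by simpa using hu.le)⟩, ?_⟩
  refine (growthNorm_le_of_forall (K := (growthNorm l f).toReal * (1 + ‖(u : ℂ)‖) ^ l)
    fun s hs => ?_).trans_lt ENNReal.ofReal_lt_top
  refine (norm_le_of_growthNorm_le hb le_rfl _ (add_mem_halfPlane hu hs)).trans ?_
  rw [mul_assoc]
  exact mul_le_mul_of_nonneg_left (one_add_norm_add_rpow_le hl _ _) ENNReal.toReal_nonneg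

theorem translate_rieszMean_mem_H (lam : Frequency) {l : ℝ} (hl : 0 ≤ l) (k : ℝ) (a : ℕ → ℂ)
    (x u : ℝ) : translate u (rieszMean lam k a x) ∈ H lam l := by
  have htr : ∀ s, translate u (rieszMean lam k a x) s = ∑ n ∈ lam.below x,
      twist lam a u n * cexp (-(lam.seq n : ℂ) * s) * (((1 - lam.seq n / x) ^ k : ℝ) : ℂ) :=
    fun s => rieszMean_add lam k a x u s
  -- A Dirichlet polynomial is its own germ, of order zero: the partial sums are constant once all
  -- its frequencies are included.
  refine ⟨?_, ⟨fun n => if n ∈ lam.below x then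
    twist lam a u n * (((1 - lam.seq n / x) ^ k : ℝ) : ℂ) else 0, 0, le_rfl, 0, ?_⟩, ?_⟩
  · rw [funext htr]
    fun_prop
  · intro s _ _
    refine tendsto_const_nhds.congr' ?_
    filter_upwards [eventually_ge_atTop x] with y hy
    rw [htr, rieszMean, ← Finset.sum_subset (below_mono lam hy)]
    · refine Finset.sum_congr rfl fun n hn => ?_
      simp [hn]
      ring
    · intro n _ hn
      simp [hn]
  · refine (growthNorm_le_of_forall (K := ∑ n ∈ lam.below x,
      ‖twist lam a u n‖ * ‖(((1 - lam.seq n / x) ^ k : ℝ) : ℂ)‖)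
      fun s hs => ?_).trans_lt ENNReal.ofReal_lt_top
    have hs : 0 < s.re := hs
    rw [htr]
    have h1 : 1 ≤ (1 + ‖s‖) ^ l := Real.one_le_rpow (by linarith [norm_nonneg s]) hl
    refine ((norm_sum_le _ _).trans (Finset.sum_le_sum fun n _ => ?_)).trans
      (le_mul_of_one_le_right (by positivity) h1)
    rw [norm_mul, norm_mul]
    gcongr
    refine mul_le_of_le_one_right (norm_nonneg _) ?_
    rw [Complex.norm_exp, Real.exp_le_one_iff]
    have := mul_nonneg (lam.nonneg n) hs.le
    simpa using this

/-- Used to replace the weight `(1 + |s|)^l` by `|1 + s|^l` at the cost of `2^l`. -/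
theorem one_add_norm_le_two_mul {s : ℂ} (hs : 0 ≤ s.re) : 1 + ‖s‖ ≤ 2 * ‖1 + s‖ := by
  have h1 : 1 ≤ ‖1 + s‖ := by
    have := Complex.re_le_norm (1 + s)
    rw [add_re, one_re] at this
    linarith
  have h2 : ‖s‖ ≤ ‖1 + s‖ := by
    rw [Complex.norm_eq_sqrt_sq_add_sq, Complex.norm_eq_sqrt_sq_add_sq]
    refine Real.sqrt_le_sqrt ?_
    simp only [add_re, one_re, add_im, one_im, zero_add]
    nlinarith
  linarith

theorem exists_rate_growthNorm_sub_le {l k u : ℝ} (hl : 0 ≤ l) (hlk : l < k) (hu : 0 < u) :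
    ∃ η : ℝ → ℝ, Tendsto η atTop (𝓝 0) ∧ ∀ (lam : Frequency) (f : ℂ → ℂ)
      (K : ℝ), 0 ≤ K → f ∈ H lam l → (∀ w ∈ halfPlane 0, ‖f w‖ ≤ K * (1 + ‖w‖) ^ l) →
        ∀ x, 1 ≤ x →
          growthNorm l (translate u f - translate u (rieszMeanFun lam k f x)) ≤
              ENNReal.ofReal (K * η x) ∧
            ⨆ s ∈ halfPlane u,
              ENNReal.ofReal ‖(f s - rieszMeanFun lam k f x s) / (1 + s) ^ (l : ℂ)‖ ≤
                ENNReal.ofReal (K * η x) := by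
  obtain ⟨η, hη, hη0, h⟩ := exists_rate_norm_sub_rieszMean_le hl hlk hu
  -- One constant covers both losses: translating the weight by `u`, and passing to `|1 + s|^l`.
  set A := (1 + ‖(u : ℂ)‖) ^ l + 2 ^ l
  have hA1 : (1 + ‖(u : ℂ)‖) ^ l ≤ A := le_add_of_nonneg_right (by positivity)
  have hA2 : (2 : ℝ) ^ l ≤ A := le_add_of_nonneg_left (by positivity)
  refine ⟨fun x => η x * A, by simpa using hη.mul_const A, ?_⟩
  intro lam f K hK hf hfb x hx
  have hest := h lam _ f K hK (isRieszGerm_bohrCoeff hf.2.1) hf.1 hfb x hx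
  have hKη : 0 ≤ K * η x := mul_nonneg hK (hη0 x)
  constructor
  · refine growthNorm_le_of_forall fun s hs => ?_
    have hs : 0 < s.re := hs
    refine (hest (u + s) (by rw [add_re, ofReal_re]; linarith)).trans ?_
    calc K * η x * (1 + ‖(u : ℂ) + s‖) ^ l
        ≤ K * η x * (A * (1 + ‖s‖) ^ l) := by
          gcongr
          exact (one_add_norm_add_rpow_le hl _ _).trans (by gcongr)
      _ = _ := by ring
  · refine iSup₂_le fun s hs => ENNReal.ofReal_le_ofReal ?_
    have hs : u < s.re := hs
    have h2 := one_add_norm_le_two_mul (hu.trans hs).le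
    have hpos : 0 < ‖1 + s‖ := by linarith [norm_nonneg s]
    rw [norm_div, norm_cpow_real, div_le_iff₀ (by positivity)]
    refine (hest s hs.le).trans ?_
    calc K * η x * (1 + ‖s‖) ^ l ≤ K * η x * (2 * ‖1 + s‖) ^ l := by gcongr
      _ = K * η x * (2 ^ l * ‖1 + s‖ ^ l) := by rw [Real.mul_rpow zero_le_two hpos.le]
      _ ≤ K * η x * (A * ‖1 + s‖ ^ l) := by gcongr
      _ = _ := by ring

theorem tendsto_growthNorm_sub {lam : Frequency} {l k u : ℝ} (hl : 0 ≤ l) (hkl : l < k)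
    {f : ℂ → ℂ} (hf : f ∈ H lam l) (hu : 0 < u) :
    Tendsto (fun x : ℝ => growthNorm l (translate u f - translate u (rieszMeanFun lam k f x)))
      atTop (𝓝 0) ∧
    Tendsto (fun x : ℝ => ⨆ s ∈ halfPlane u,
      ENNReal.ofReal ‖(f s - rieszMeanFun lam k f x s) / (1 + s) ^ (l : ℂ)‖) atTop (𝓝 0) := by
  obtain ⟨η, hη, h⟩ := exists_rate_growthNorm_sub_le hl hkl hu
  have hle := h lam f _ ENNReal.toReal_nonneg hf (norm_le_of_growthNorm_le hf.2.2 le_rfl)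
  have hlim : Tendsto (fun x => ENNReal.ofReal ((growthNorm l f).toReal * η x)) atTop (𝓝 0) := by
    have := ENNReal.tendsto_ofReal (hη.const_mul (growthNorm l f).toReal)
    simpa using this
  constructor <;> refine tendsto_of_tendsto_of_tendsto_of_le_of_le' tendsto_const_nhds hlim
    (Eventually.of_forall fun _ => zero_le) ?_ <;>
    filter_upwards [eventually_ge_atTop 1] with x hx
  exacts [(hle x hx).1, (hle x hx).2]

end RieszDirichlet

end

theorem mainTheorem2 (lam : RieszDirichlet.Frequency) (k l : ℝ) (hl : 0 ≤ l) (hkl : l < k) :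
    -- the Riesz germ of an element of the space is unique, so its Riesz means are well defined
    (∀ f ∈ RieszDirichlet.H lam l, ∃! a : ℕ → ℂ, RieszDirichlet.IsRieszGerm lam a f) ∧
    -- uniform Riesz approximation on bounded sets
    (∀ M : Set (ℂ → ℂ), M ⊆ RieszDirichlet.H lam l →
      (⨆ f ∈ M, RieszDirichlet.growthNorm l f) < ⊤ →
      ∀ ε : ℝ, 0 < ε → ∀ u : ℝ, 0 < u → ∃ x₀ : ℝ, 0 < x₀ ∧
        (⨆ x : ℝ, ⨆ _ : x₀ < x, ⨆ f ∈ M,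
          RieszDirichlet.growthNorm l (RieszDirichlet.translate u f -
            RieszDirichlet.translate u (RieszDirichlet.rieszMeanFun lam k f x)))
          ≤ ENNReal.ofReal ε) ∧
    -- consequences for a single function
    (∀ f ∈ RieszDirichlet.H lam l,
      -- norm convergence of the translated Riesz means in the space
      (∀ u : ℝ, 0 < u →
        RieszDirichlet.translate u f ∈ RieszDirichlet.H lam l ∧
        (∀ x : ℝ, 0 < x → RieszDirichlet.translate u (RieszDirichlet.rieszMeanFun lam k f x)
          ∈ RieszDirichlet.H lam l) ∧
        Filter.Tendsto (fun x : ℝ =>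
          RieszDirichlet.growthNorm l (RieszDirichlet.translate u f -
            RieszDirichlet.translate u (RieszDirichlet.rieszMeanFun lam k f x)))
          Filter.atTop (nhds 0)) ∧
      -- weighted uniform convergence on smaller half-planes
      (∀ u : ℝ, 0 < u →
        Filter.Tendsto (fun x : ℝ => ⨆ s ∈ RieszDirichlet.halfPlane u,
          ENNReal.ofReal ‖(f s - RieszDirichlet.rieszMeanFun lam k f x s) / (1 + s) ^ (l : ℂ)‖)
          Filter.atTop (nhds 0)) ∧
      -- pointwise summability
      (∀ s ∈ RieszDirichlet.halfPlane 0,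
        Filter.Tendsto (fun x : ℝ => RieszDirichlet.rieszMeanFun lam k f x s)
          Filter.atTop (nhds (f s)))) := by
  refine ⟨fun f hf => ?_, fun M hM hbdd ε hε u hu => ?_, fun f hf => ⟨fun u hu => ⟨?_, ?_, ?_⟩,
    fun u hu => (RieszDirichlet.tendsto_growthNorm_sub hl hkl hf hu).2, fun s hs => ?_⟩⟩
  · obtain ⟨a, ha⟩ := hf.2.1
    exact ⟨a, ha, fun b hb => hb.unique ha⟩
  · obtain ⟨η, hη, h⟩ := RieszDirichlet.exists_rate_growthNorm_sub_le hl hkl hu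
    set K := (⨆ f ∈ M, RieszDirichlet.growthNorm l f).toReal
    have hlim : Filter.Tendsto (fun x => K * η x) Filter.atTop (nhds 0) := by
      simpa using hη.const_mul K
    obtain ⟨X, hX⟩ := Filter.eventually_atTop.1 (hlim.eventually (gt_mem_nhds hε))
    refine ⟨max X 1, by positivity, iSup₂_le fun x hx => iSup₂_le fun f hf => ?_⟩
    have hX1 : X ≤ x := (le_max_left X 1).trans hx.le
    have h1 : 1 ≤ x := (le_max_right X 1).trans hx.le
    have hfb := RieszDirichlet.norm_le_of_growthNorm_le hbdd
      (le_iSup₂ (f := fun f (_ : f ∈ M) => RieszDirichlet.growthNorm l f) f hf)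
    exact ((h lam f K ENNReal.toReal_nonneg (hM hf) hfb x h1).1).trans
      (ENNReal.ofReal_le_ofReal (hX x hX1).le)
  · exact RieszDirichlet.translate_mem_H hl hf hu
  · exact fun x _ => RieszDirichlet.translate_rieszMean_mem_H lam hl k _ x u
  · exact (RieszDirichlet.tendsto_growthNorm_sub hl hkl hf hu).1
  · have hs : 0 < s.re := hs
    -- For a single point, the half-plane `[Re ≥ u]` with `u = Re s` suffices.
    obtain ⟨η, hη, _, h⟩ := RieszDirichlet.exists_rate_norm_sub_rieszMean_le hl hkl hs
    have hest := h lam _ f _ ENNReal.toReal_nonneg (RieszDirichlet.isRieszGerm_bohrCoeff hf.2.1)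
      hf.1 (RieszDirichlet.norm_le_of_growthNorm_le hf.2.2 le_rfl)
    rw [tendsto_iff_norm_sub_tendsto_zero]
    have hlim := (hη.const_mul (RieszDirichlet.growthNorm l f).toReal).mul_const ((1 + ‖s‖) ^ l)
    rw [mul_zero, zero_mul] at hlim
    refine squeeze_zero' (Filter.Eventually.of_forall fun _ => norm_nonneg _) ?_ hlim
    filter_upwards [Filter.eventually_ge_atTop 1] with x hx
    rw [norm_sub_rev]
    exact hest x hx s le_rfl
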